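/- Let $n,a\ge 0$ be integers with $n+a\ge 1$, let $m=2^n$, and let $0<\epsilon<\tau<1$ and $0<\delta<\tfrac12$. An oracle $O_D$ is a unitary operator on $\log_2 m+a=n+a$ qubits. Write $O_D|0^{n+a}\rangle=\sum_{x\in\{0,1\}^n}\alpha_x|x\rangle|\psi_x\rangle$ with unit vectors $|\psi_x\rangle$, so that $p_x=|\alpha_x|^2$ is the probability of observing $x$ when the first $n$ qubits of this state are measured in the standard basis. A quantum algorithm on $N$ qubits starts in $|0^N\rangle$ and applies a finite sequence of steps, fixed in advance. Each step is either a unitary that does not depend on $O_D$, or a query, that is, one application of $O_D$ or of $O_D^{\dagger}$ to some $n+a$ of the $N$ qubits. At the end the state is measured in the standard basis, and one fixed qubit is the output register. There is an absolute constant $C>0$ such that for all $m=2^n,a,\tau,\epsilon,\delta$ as above there is a quantum algorithm, depending only on $m,a,\tau,\epsilon,\delta$ and not on $O_D$, that uses at most $$C\,\bigl(\log_2 m+\log_2\tfrac1\epsilon+a\bigr)\log_2\tfrac{1}{\delta\tau}$$ qubits, makes at most $$C\,\frac{1}{\epsilon\sqrt\tau}\,\log_2\tfrac{1}{\delta\tau}$$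 queries, and satisfies the following for every oracle $O_D$ on $n+a$ qubits. 1. If $p_x<\tau-\epsilon$ for all $x$, then the output register is observed in the state $|0\rangle$ with probability at least $1-\delta$. 2. If $p_x\ge\tau$ for some $x$, then the output register is observed in the state $|1\rangle$ with probability at least $1-\delta$. -/

import Mathlib

/-- Labels of the standard basis of `k` qubits. -/
abbrev BitString (k : ℕ) : Type := Fin k → Bool

/-- A unitary on `n + a` qubits, in the standard basis. The first `n` qubits carry the outcome `x`;
the other `a` qubits carry the accompanying states `ψ_x`. -/
abbrev DistOracle (n a : ℕ) : Type :=
  Matrix.unitaryGroup (BitString n × BitString a) ℂ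

/-- `p_x`: the probability of observing `x` when the first `n` qubits of `O |0...0⟩` are measured
in the standard basis. -/
noncomputable def DistOracle.outcomeProb {n a : ℕ} (O : DistOracle n a) (x : BitString n) : ℝ :=
  ∑ w : BitString a,
    ‖(O : Matrix (BitString n × BitString a) (BitString n × BitString a) ℂ)
      (x, w) (fun _ => false, fun _ => false)‖ ^ 2

/-- The part of a basis label of `N` qubits that sits on the `n + a` distinct qubits `e`. -/
def readWires {n a N : ℕ} (e : Fin n ⊕ Fin a ↪ Fin N) (y : BitString N) :
    BitString n × BitString a :=
  (fun i => y (e (Sum.inl i)), fun j => y (e (Sum.inr j)))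

/-- The operator on `N` qubits that acts as `M` on the `n + a` distinct qubits `e` and as the
identity on all the others. -/
def onWires {n a N : ℕ} (e : Fin n ⊕ Fin a ↪ Fin N)
    (M : Matrix (BitString n × BitString a) (BitString n × BitString a) ℂ) :
    Matrix (BitString N) (BitString N) ℂ :=
  Matrix.of fun y z =>
    if ∀ i : Fin N, (∀ j, e j ≠ i) → y i = z i then M (readWires e y) (readWires e z) else 0

/-- One step of a quantum query algorithm on `N` qubits: a unitary that does not depend on the
oracle, or one application of the oracle or of its inverse to `n + a` distinct qubits. -/
inductive QueryStep (n a N : ℕ) : Type where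
  | free (U : Matrix.unitaryGroup (BitString N) ℂ) : QueryStep n a N
  | query (e : Fin n ⊕ Fin a ↪ Fin N) : QueryStep n a N
  | queryInv (e : Fin n ⊕ Fin a ↪ Fin N) : QueryStep n a N

/-- The number of queries that a step makes. -/
def QueryStep.cost {n a N : ℕ} : QueryStep n a N → ℕ
  | .free _ => 0
  | .query _ => 1
  | .queryInv _ => 1

/-- The operator that a step applies, for a given oracle. -/
def QueryStep.toMatrix {n a N : ℕ} (O : DistOracle n a) :
    QueryStep n a N → Matrix (BitString N) (BitString N) ℂ
  | .free U => (U : Matrix (BitString N) (BitString N) ℂ)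
  | .query e => onWires e (O : Matrix (BitString n × BitString a) (BitString n × BitString a) ℂ)
  | .queryInv e =>
      onWires e
        (O : Matrix (BitString n × BitString a) (BitString n × BitString a) ℂ).conjTranspose

/-- A quantum query algorithm on `N` qubits (counting the qubits on which the oracle acts) with
access to an oracle on `n + a` qubits: its steps, in order of execution, and its output qubit. -/
structure QueryAlgorithm (n a N : ℕ) : Type where
  steps : List (QueryStep n a N)
  output : Fin N

/-- The total number of queries to the oracle and to its inverse. -/
def QueryAlgorithm.queries {n a N : ℕ} (A : QueryAlgorithm n a N) : ℕ :=
  (A.steps.map QueryStep.cost).sum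

/-- The final state, in the standard basis, starting from `|0...0⟩`. -/
noncomputable def QueryAlgorithm.finalState {n a N : ℕ} (A : QueryAlgorithm n a N)
    (O : DistOracle n a) : BitString N → ℂ :=
  A.steps.foldl (fun v s => (s.toMatrix O).mulVec v) (Pi.single (fun _ => false) 1)

/-- The probability that the output qubit is observed in the state `|b⟩` when the final state is
measured in the standard basis. -/
noncomputable def QueryAlgorithm.outputProb {n a N : ℕ} (A : QueryAlgorithm n a N)
    (O : DistOracle n a) (b : Bool) : ℝ :=
  ∑ y : BitString N, if y A.output = b then ‖A.finalState O y‖ ^ 2 else 0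

/-! The algorithm nests two amplitude estimations. For a fixed outcome `x`, take the Grover iterate
of the oracle with the basis states over `x` marked. On the orbit of `O|0⟩` it acts like a rotation
with phases `±φ`, where `|sin (φ / 2)| = √p_x`. Phase estimation therefore separates `√p_x ≤ √(τ -
ε)` from `√p_x ≥ √τ`, a gap of at least `ε / (2√τ)`. A second copy of `O|0⟩` supplies `x` in
superposition, which makes the inner test a single unitary `V`: each `x` occurs with weight `p_x`
and is flagged or not by the clock. If the inner error is at most `τ / 16`, the flagged mass of
`V|0⟩` is at most `τ / 16` when every `p_x < τ - ε`, and at least `τ (1 - τ / 16)` when some `p_x ≥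
τ`. Amplitude estimation on `V` tells these apart, the amplitudes being at most `√τ / 4` or at least
`√τ / 2`.

The query bound leaves no room for a logarithm in the inner test. With a tent-shaped clock state of
length `M`, the estimate of `|sin (φ / 2)|` has mean square error `O(1 / M²)`, so Chebyshev's
inequality gives failure probability `O(1 / (M * gap)²)`, and `M` of order `1 / ε` already makes
this `O(τ)`. The outer test needs a clock of length `O(1 / √τ)` for a constant error; a majority
vote over about `log (1 / δ)` clocks brings the error down to `δ`. The query counts multiply.

The main lemmas are `sum_norm_sq_orbit` (reduction to phases without eigenvectors),
`PhaseTest.tentTest_moment`, `PhaseTest.Separates.majority`, `Realizes.controlled_groverIterate`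
(query count) and `exists_detector` (the nesting). -/

open Matrix in
/-- Every unit vector is a prescribed column of some unitary matrix. -/
theorem exists_unitary_col {κ : Type*} [Fintype κ] [DecidableEq κ] (b₀ : κ) (v : κ → ℂ)
    (hv : ∑ b, ‖v b‖ ^ 2 = 1) :
    ∃ U ∈ Matrix.unitaryGroup κ ℂ, ∀ b, U b b₀ = v b := by
  let w : κ → EuclideanSpace ℂ κ := fun _ => WithLp.toLp 2 v
  have hw : Orthonormal ℂ (({b₀} : Set κ).domRestrict w) := by
    constructor
    · intro i
      simp [w, EuclideanSpace.norm_eq, Set.domRestrict, hv]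
    · intro i j hij
      exact absurd (Subsingleton.elim i j) hij
  obtain ⟨b, hb⟩ := hw.exists_orthonormalBasis_extension_of_card_eq (by simp)
  refine ⟨(EuclideanSpace.basisFun κ ℂ).toBasis.toMatrix b,
    (EuclideanSpace.basisFun κ ℂ).toMatrix_orthonormalBasis_mem_unitary b, fun i => ?_⟩
  rw [Module.Basis.toMatrix_apply, hb b₀ rfl]
  simp [w]

/-! ### Grover iterates: the orbit of the initial state and its Gram matrix. -/

section Grover

open Matrix

variable {β : Type*} [Fintype β] [DecidableEq β]

/-- The reflection that flips the sign of the marked basis states. -/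
def phaseFlip (mark : β → Prop) [DecidablePred mark] : Matrix β β ℂ :=
  Matrix.diagonal fun y => if mark y then -1 else 1

/-- The Grover iterate for the state `B e_{y₀}` and the marked subspace. -/
def groverIterate (B : Matrix β β ℂ) (y₀ : β) (mark : β → Prop) [DecidablePred mark] :
    Matrix β β ℂ :=
  B * phaseFlip (· ≠ y₀) * Bᴴ * phaseFlip mark

theorem phaseFlip_conjTranspose (mark : β → Prop) [DecidablePred mark] :
    (phaseFlip mark)ᴴ = phaseFlip mark := by
  unfold phaseFlip
  rw [diagonal_conjTranspose]
  congr 1; ext y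
  by_cases h : mark y <;> simp [h]

theorem phaseFlip_mul_self (mark : β → Prop) [DecidablePred mark] :
    phaseFlip mark * phaseFlip mark = 1 := by
  unfold phaseFlip
  rw [diagonal_mul_diagonal, ← diagonal_one]
  congr 1; ext y
  by_cases h : mark y <;> simp [h]

theorem phaseFlip_mem (mark : β → Prop) [DecidablePred mark] :
    phaseFlip mark ∈ Matrix.unitaryGroup β ℂ := by
  rw [Matrix.mem_unitaryGroup_iff, star_eq_conjTranspose, phaseFlip_conjTranspose,
    phaseFlip_mul_self]

variable {B : Matrix β β ℂ} (y₀ : β) (mark : β → Prop) [DecidablePred mark]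

theorem groverIterate_mem (hB : B ∈ Matrix.unitaryGroup β ℂ) :
    groverIterate B y₀ mark ∈ Matrix.unitaryGroup β ℂ :=
  mul_mem (mul_mem (mul_mem hB (phaseFlip_mem _)) (Unitary.star_mem hB)) (phaseFlip_mem _)

theorem mulVec_single_eq_col (B : Matrix β β ℂ) : B *ᵥ Pi.single y₀ 1 = fun y => B y y₀ := by
  ext y; simp

/-- Marking everything except `y₀` gives `2|e⟩⟨e| - 1` rather than its negative, so the iterate has
phases `±φ` without an extra factor `-1`. -/
theorem phaseFlip_ne_mulVec (v : β → ℂ) :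
    phaseFlip (· ≠ y₀) *ᵥ v = (2 * v y₀) • Pi.single y₀ (1 : ℂ) - v := by
  ext y
  simp only [phaseFlip, mulVec_diagonal]
  by_cases h : y = y₀
  · subst h; simp; ring
  · simp [h]

/-- The iterate and its inverse add up to a scalar on the state they are built from. -/
theorem groverIterate_add_conjTranspose (hB : B ∈ Matrix.unitaryGroup β ℂ) :
    groverIterate B y₀ mark *ᵥ (fun y => B y y₀) + (groverIterate B y₀ mark)ᴴ *ᵥ (fun y => B y y₀)
      = (2 * (1 - 2 * ((∑ y, if mark y then ‖B y y₀‖ ^ 2 else 0 : ℝ) : ℂ))) •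
        (fun y => B y y₀) := by
  have hBB : Bᴴ * B = 1 := Matrix.mem_unitaryGroup_iff'.1 hB
  have hBB' : B * Bᴴ = 1 := Matrix.mem_unitaryGroup_iff.1 hB
  set i : β → ℂ := fun y => B y y₀ with hi
  have hBi : Bᴴ *ᵥ i = Pi.single y₀ 1 := by
    rw [hi, ← mulVec_single_eq_col, mulVec_mulVec, hBB, one_mulVec]
  -- The reflection about `i` fixes `i`, so the inverse iterate just applies the flip `F`. The
  -- iterate itself gives `2⟨i, F i⟩ i - F i`, and the terms `F i` cancel in the sum.
  have h1 : (groverIterate B y₀ mark)ᴴ *ᵥ i = phaseFlip mark *ᵥ i := by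
    rw [groverIterate]
    simp only [conjTranspose_mul, conjTranspose_conjTranspose, phaseFlip_conjTranspose,
      ← mulVec_mulVec, hBi, phaseFlip_ne_mulVec]
    rw [Pi.single_eq_same, mul_one, two_smul, add_sub_cancel_right, mulVec_single_eq_col]
  have h2 : (Bᴴ *ᵥ (phaseFlip mark *ᵥ i)) y₀
      = 1 - 2 * ((∑ y, if mark y then ‖B y y₀‖ ^ 2 else 0 : ℝ) : ℂ) := by
    have h3 : (Bᴴ *ᵥ i) y₀ = 1 := by rw [hBi]; simp
    rw [← h3]
    simp only [mulVec, dotProduct, phaseFlip, conjTranspose_apply, hi]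
    push_cast
    rw [Finset.mul_sum, ← Finset.sum_sub_distrib]
    refine Finset.sum_congr rfl fun y _ => ?_
    have : star (B y y₀) * B y y₀ = (‖B y y₀‖ : ℂ) ^ 2 := Complex.conj_mul' _
    rw [Finset.sum_eq_single y (by intro z _ hz; simp [hz.symm]) (by simp)]
    by_cases h : mark y
    · simp only [diagonal_apply_eq, h, if_true, Complex.ofReal_pow]
      linear_combination (-2 : ℂ) * this
    · simp [h]
  rw [h1, groverIterate]
  simp only [← mulVec_mulVec, phaseFlip_ne_mulVec, mulVec_sub, mulVec_smul]
  rw [h2, mulVec_single_eq_col, mulVec_mulVec, hBB', one_mulVec, add_comm, add_sub_assoc']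
  simp [hi]

theorem dotProduct_star_col (hB : B ∈ Matrix.unitaryGroup β ℂ) :
    star (fun y => B y y₀) ⬝ᵥ (fun y => B y y₀) = 1 := by
  have := congrFun (congrFun (Matrix.mem_unitaryGroup_iff'.1 hB) y₀) y₀
  simpa [Matrix.mul_apply, dotProduct] using this

theorem sum_norm_sq_col (hB : B ∈ Matrix.unitaryGroup β ℂ) : ∑ y, ‖B y y₀‖ ^ 2 = 1 := by
  have h := dotProduct_star_col y₀ hB
  have h2 : ((∑ y, ‖B y y₀‖ ^ 2 : ℝ) : ℂ) = 1 := by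
    rw [← h]
    push_cast
    exact Finset.sum_congr rfl fun y _ => (Complex.conj_mul' _).symm
  exact_mod_cast h2

/-- The mass of the marked subspace in a column. -/
noncomputable def markedMass (B : Matrix β β ℂ) (y₀ : β) (mark : β → Prop) [DecidablePred mark] :
    ℝ :=
  ∑ y, if mark y then ‖B y y₀‖ ^ 2 else 0

theorem markedMass_nonneg (B : Matrix β β ℂ) : 0 ≤ markedMass B y₀ mark :=
  Finset.sum_nonneg fun _ _ => by split_ifs <;> positivity

theorem markedMass_le_one (hB : B ∈ Matrix.unitaryGroup β ℂ) : markedMass B y₀ mark ≤ 1 := by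
  rw [← sum_norm_sq_col y₀ hB]
  exact Finset.sum_le_sum fun _ _ => by split_ifs; exacts [le_rfl, by positivity]

theorem star_dotProduct_groverIterate_col (hB : B ∈ Matrix.unitaryGroup β ℂ) :
    star (fun y => B y y₀) ⬝ᵥ (groverIterate B y₀ mark *ᵥ (fun y => B y y₀))
      = ((1 - 2 * markedMass B y₀ mark : ℝ) : ℂ) := by
  have hBB : Bᴴ * B = 1 := Matrix.mem_unitaryGroup_iff'.1 hB
  have h1 := dotProduct_star_col y₀ hB
  have hB1 : star (fun y => B y y₀) ᵥ* B = Pi.single y₀ 1 := by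
    have := congrArg star (show Bᴴ *ᵥ (fun y => B y y₀) = Pi.single y₀ 1 by
      rw [← mulVec_single_eq_col, mulVec_mulVec, hBB, one_mulVec])
    rw [star_mulVec, conjTranspose_conjTranspose] at this
    rw [this]
    ext y; by_cases h : y = y₀
    · subst h; simp
    · simp [h]
  have hP : Pi.single y₀ 1 ᵥ* phaseFlip (· ≠ y₀) = (Pi.single y₀ 1 : β → ℂ) := by
    ext y; by_cases h : y = y₀
    · subst h; simp [phaseFlip]
    · simp [phaseFlip, h]
  have hC : (Pi.single y₀ 1 : β → ℂ) ᵥ* Bᴴ = star (fun y => B y y₀) := by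
    ext y; simp
  rw [dotProduct_mulVec, groverIterate, ← vecMul_vecMul, ← vecMul_vecMul, ← vecMul_vecMul, hB1, hP,
    hC, ← dotProduct_mulVec, phaseFlip, Complex.ofReal_sub, Complex.ofReal_one,
    markedMass]
  refine Eq.trans ?_ (congrArg (· - _) h1)
  simp only [dotProduct, mulVec_diagonal, Pi.star_apply]
  push_cast
  rw [Finset.mul_sum, ← Finset.sum_sub_distrib]
  refine Finset.sum_congr rfl fun y _ => ?_
  have : star (B y y₀) * B y y₀ = (‖B y y₀‖ : ℂ) ^ 2 := Complex.conj_mul' _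
  by_cases h : mark y
  · simp only [h, if_true, Complex.ofReal_pow]; linear_combination (-2 : ℂ) * this
  · simp [h]

/-- The rotation angle of the Grover iterate. -/
noncomputable def groverAngle (B : Matrix β β ℂ) (y₀ : β) (mark : β → Prop) [DecidablePred mark] :
    ℝ :=
  Real.arccos (1 - 2 * markedMass B y₀ mark)

theorem cos_groverAngle (hB : B ∈ Matrix.unitaryGroup β ℂ) :
    Real.cos (groverAngle B y₀ mark) = 1 - 2 * markedMass B y₀ mark := by
  have h1 := markedMass_nonneg y₀ mark B
  have h2 := markedMass_le_one y₀ mark hB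
  exact Real.cos_arccos (by linarith) (by linarith)

theorem abs_sin_half_groverAngle (hB : B ∈ Matrix.unitaryGroup β ℂ) :
    |Real.sin (groverAngle B y₀ mark / 2)| = √(markedMass B y₀ mark) := by
  have h := cos_groverAngle y₀ mark hB
  rw [← Real.sqrt_sq_eq_abs, Real.sin_sq_eq_half_sub, mul_div_cancel₀ _ two_ne_zero, h]
  congr 1; ring

/-- Since `W i + Wᴴ i = 2 cos φ • i`, the vectors `W ^ j i` satisfy the Chebyshev recurrence, which
is also that of `cos (j φ)`. No spectral decomposition of `W` is needed. -/
theorem star_dotProduct_groverIterate_pow (hB : B ∈ Matrix.unitaryGroup β ℂ) (j : ℕ) :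
    star (fun y => B y y₀) ⬝ᵥ (groverIterate B y₀ mark ^ j *ᵥ (fun y => B y y₀))
      = (Real.cos (j * groverAngle B y₀ mark) : ℂ) := by
  have hW := groverIterate_mem y₀ mark hB
  have hc := cos_groverAngle y₀ mark hB
  have h1 := star_dotProduct_groverIterate_col y₀ mark hB
  have h2 := groverIterate_add_conjTranspose y₀ mark hB
  rw [← markedMass] at h2
  rw [← hc] at h1
  set W := groverIterate B y₀ mark
  set φ := groverAngle B y₀ mark
  set i : β → ℂ := fun y => B y y₀
  have hWW : W * Wᴴ = 1 := Matrix.mem_unitaryGroup_iff.1 hW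
  induction j using Nat.twoStepInduction with
  | zero => simpa using dotProduct_star_col y₀ hB
  | one => simpa using h1
  | more j ih0 ih1 =>
    have h3 : W ^ (j + 2) *ᵥ i = (2 * (Real.cos φ : ℂ)) • (W ^ (j + 1) *ᵥ i) - W ^ j *ᵥ i := by
      rw [← mulVec_smul, show (2 * (Real.cos φ : ℂ)) • i = W *ᵥ i + Wᴴ *ᵥ i by
        rw [h2, hc]; push_cast; rfl]
      rw [mulVec_add, mulVec_mulVec, mulVec_mulVec, pow_succ W j, mul_assoc (W ^ j) W Wᴴ, hWW,
        mul_one, ← pow_succ, ← pow_succ]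
      simp
    rw [h3, dotProduct_sub, dotProduct_smul, ih0, ih1]
    have h4 : Real.cos ((j + 2 : ℕ) * φ)
        = 2 * Real.cos φ * Real.cos ((j + 1 : ℕ) * φ) - Real.cos (j * φ) := by
      have e1 : ((j + 2 : ℕ) : ℝ) * φ = (j + 1 : ℕ) * φ + φ := by push_cast; ring
      have e2 : (j : ℝ) * φ = (j + 1 : ℕ) * φ - φ := by push_cast; ring
      rw [e1, e2, Real.cos_add, Real.cos_sub]; ring
    rw [h4]; push_cast; simp

/-- The Gram matrix of the orbit of the state under the Grover iterate. -/
theorem gram_groverIterate (hB : B ∈ Matrix.unitaryGroup β ℂ) (k l : ℕ) :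
    star (groverIterate B y₀ mark ^ k *ᵥ (fun y => B y y₀)) ⬝ᵥ
        (groverIterate B y₀ mark ^ l *ᵥ (fun y => B y y₀))
      = (Real.cos (((l : ℝ) - k) * groverAngle B y₀ mark) : ℂ) := by
  have key : ∀ k j : ℕ, star (groverIterate B y₀ mark ^ k *ᵥ (fun y => B y y₀)) ⬝ᵥ
        (groverIterate B y₀ mark ^ (k + j) *ᵥ (fun y => B y y₀))
      = (Real.cos (j * groverAngle B y₀ mark) : ℂ) := by
    intro k j
    have hW : (groverIterate B y₀ mark ^ k)ᴴ * groverIterate B y₀ mark ^ k = 1 :=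
      Matrix.mem_unitaryGroup_iff'.1 (pow_mem (groverIterate_mem y₀ mark hB) k)
    rw [star_mulVec, ← dotProduct_mulVec, mulVec_mulVec, pow_add, ← mul_assoc, hW, one_mul,
      star_dotProduct_groverIterate_pow y₀ mark hB]
  rcases le_total k l with h | h
  · obtain ⟨j, rfl⟩ := Nat.exists_eq_add_of_le h
    rw [key]; push_cast; simp
  · obtain ⟨j, rfl⟩ := Nat.exists_eq_add_of_le h
    have := congrArg star (key l j)
    rw [star_dotProduct, star_star] at this
    rw [this, Complex.star_def, Complex.conj_ofReal, ← Real.cos_neg]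
    push_cast; ring_nf

/-- A superposition of points of the orbit has the norm of a superposition of phases. -/
theorem sum_norm_sq_orbit (hB : B ∈ Matrix.unitaryGroup β ℂ) {κ : Type*} [Fintype κ]
    (g : κ → ℂ) (k : κ → ℕ) :
    ∑ y, ‖∑ b, g b * (groverIterate B y₀ mark ^ k b *ᵥ (fun y => B y y₀)) y‖ ^ 2
      = (‖∑ b, g b * Complex.exp (k b * groverAngle B y₀ mark * Complex.I)‖ ^ 2
        + ‖∑ b, g b * Complex.exp (k b * (-groverAngle B y₀ mark : ℝ) * Complex.I)‖ ^ 2) / 2 := by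
  set φ := groverAngle B y₀ mark
  have hgram := gram_groverIterate y₀ mark hB
  set u : ℕ → β → ℂ := fun k => groverIterate B y₀ mark ^ k *ᵥ (fun y => B y y₀)
  have sq : ∀ f : κ → ℂ, ((‖∑ b, f b‖ ^ 2 : ℝ) : ℂ) = ∑ b, ∑ c, star (f b) * f c := by
    intro f
    push_cast
    rw [← Complex.conj_mul', map_sum, Finset.sum_mul_sum]
    rfl
  apply Complex.ofReal_injective
  have hl : ((∑ y, ‖∑ b, g b * u (k b) y‖ ^ 2 : ℝ) : ℂ)
      = ∑ b, ∑ c, star (g b) * g c * (Real.cos (((k c : ℝ) - k b) * φ) : ℂ) := by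
    rw [Complex.ofReal_sum]
    simp only [sq]
    rw [Finset.sum_comm]
    refine Finset.sum_congr rfl fun b _ => ?_
    rw [Finset.sum_comm]
    refine Finset.sum_congr rfl fun c _ => ?_
    rw [← hgram, dotProduct, Finset.mul_sum]
    refine Finset.sum_congr rfl fun y _ => ?_
    simp only [star_mul', Pi.star_apply, u]
    ring
  rw [hl]
  rw [Complex.ofReal_div, Complex.ofReal_add, sq, sq, ← Finset.sum_add_distrib, Finset.sum_div]
  refine Finset.sum_congr rfl fun b _ => ?_
  rw [← Finset.sum_add_distrib, Finset.sum_div]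
  refine Finset.sum_congr rfl fun c _ => ?_
  -- Split into exponentials, the Gram matrix is the average of two rank-one kernels, one for the
  -- phase `φ` and one for `-φ`.
  have hcos : (Real.cos (((k c : ℝ) - k b) * φ) : ℂ)
      = (Complex.exp (-(k b * φ * Complex.I)) * Complex.exp (k c * φ * Complex.I)
        + Complex.exp (k b * φ * Complex.I) * Complex.exp (-(k c * φ * Complex.I))) / 2 := by
    rw [Complex.ofReal_cos, Complex.cos, ← Complex.exp_add, ← Complex.exp_add]
    push_cast
    ring_nf
  have hs : ∀ (t : ℝ), star (Complex.exp (k b * t * Complex.I))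
      = Complex.exp (-(k b * t * Complex.I)) := by
    intro t
    rw [Complex.star_def, ← Complex.exp_conj]
    simp
  rw [hcos, star_mul', star_mul', hs, hs]
  push_cast
  have e : ∀ x : ℂ, x * -(φ : ℂ) * Complex.I = -(x * φ * Complex.I) := by intro x; ring
  rw [e, e, neg_neg]
  ring

end Grover

/-! ### Phase tests on a clock register. -/

open Matrix

/-- A phase test on a clock register: the clock is prepared in a superposition of its basis states
`b`, each of which acquires the phase `time b * φ`; the clock is then read out in another
orthonormal basis, and the outcome is accepted or not. -/
structure PhaseTest (κ : Type*) [Fintype κ] [DecidableEq κ] where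
  prep : κ → ℂ
  prep_unit : ∑ b, ‖prep b‖ ^ 2 = 1
  time : κ → ℕ
  readout : Matrix κ κ ℂ
  readout_mem : readout ∈ Matrix.unitaryGroup κ ℂ
  accept : κ → Bool

theorem sum_norm_sq_mulVec {κ : Type*} [Fintype κ] [DecidableEq κ] {Q : Matrix κ κ ℂ}
    (hQ : Q ∈ Matrix.unitaryGroup κ ℂ) (v : κ → ℂ) :
    ∑ j, ‖(Q *ᵥ v) j‖ ^ 2 = ∑ b, ‖v b‖ ^ 2 := by
  have key : ∀ w : κ → ℂ, ((∑ b, ‖w b‖ ^ 2 : ℝ) : ℂ) = star w ⬝ᵥ w := by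
    intro w
    push_cast
    exact Finset.sum_congr rfl fun y _ => (Complex.conj_mul' _).symm
  apply Complex.ofReal_injective
  rw [key, key, star_mulVec, ← dotProduct_mulVec, mulVec_mulVec,
    show Qᴴ * Q = 1 from Matrix.mem_unitaryGroup_iff'.1 hQ, one_mulVec]

namespace PhaseTest

variable {κ κ' : Type*} [Fintype κ] [DecidableEq κ] [Fintype κ'] [DecidableEq κ']

/-- The amplitude of the outcome `j` for the phase `φ`. -/
noncomputable def amp (T : PhaseTest κ) (φ : ℝ) (j : κ) : ℂ :=
  ∑ b, T.readout j b * T.prep b * Complex.exp (T.time b * φ * Complex.I)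

/-- The probability of acceptance for the phase `φ`. -/
noncomputable def prob (T : PhaseTest κ) (φ : ℝ) : ℝ :=
  ∑ j, if T.accept j then ‖T.amp φ j‖ ^ 2 else 0

theorem norm_exp_time (t : ℕ) (φ : ℝ) : ‖Complex.exp (t * φ * Complex.I)‖ = 1 := by
  have := Complex.norm_exp_ofReal_mul_I (t * φ)
  push_cast at this; exact this

theorem sum_norm_sq_amp (T : PhaseTest κ) (φ : ℝ) : ∑ j, ‖T.amp φ j‖ ^ 2 = 1 := by
  have h := sum_norm_sq_mulVec T.readout_mem
    (fun b => T.prep b * Complex.exp (T.time b * φ * Complex.I))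
  simp only [norm_mul, norm_exp_time, mul_one, T.prep_unit] at h
  rw [← h]
  simp only [amp, mulVec, dotProduct, mul_assoc]

/-- The test accepts phases with `|sin (φ / 2)| ≥ hi` and rejects those with `|sin (φ / 2)| ≤ lo`,
up to an error probability `η`. -/
def Separates (T : PhaseTest κ) (lo hi η : ℝ) : Prop :=
  ∀ φ : ℝ, (|Real.sin (φ / 2)| ≤ lo → T.prob φ ≤ η) ∧
    (hi ≤ |Real.sin (φ / 2)| → 1 - η ≤ T.prob φ)

/-- Relabelling the basis of the clock. -/
def map (e : κ ≃ κ') (T : PhaseTest κ) : PhaseTest κ' where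
  prep := T.prep ∘ e.symm
  prep_unit := by
    rw [← T.prep_unit]
    exact Equiv.sum_comp e.symm fun b => ‖T.prep b‖ ^ 2
  time := T.time ∘ e.symm
  readout := T.readout.submatrix e.symm e.symm
  readout_mem := by
    have h := Matrix.mem_unitaryGroup_iff.1 T.readout_mem
    rw [Matrix.mem_unitaryGroup_iff, star_eq_conjTranspose, conjTranspose_submatrix,
      submatrix_mul_equiv, ← star_eq_conjTranspose, h, submatrix_one_equiv]
  accept := T.accept ∘ e.symm

theorem prob_map (e : κ ≃ κ') (T : PhaseTest κ) (φ : ℝ) : (T.map e).prob φ = T.prob φ := by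
  have h : ∀ j, (T.map e).amp φ j = T.amp φ (e.symm j) := fun j =>
    Equiv.sum_comp e.symm fun b =>
      T.readout (e.symm j) b * T.prep b * Complex.exp (T.time b * φ * Complex.I)
  simp only [prob, h]
  exact Equiv.sum_comp e.symm fun j => if T.accept j then ‖T.amp φ j‖ ^ 2 else 0

theorem Separates.map {T : PhaseTest κ} {lo hi η : ℝ} (h : T.Separates lo hi η) (e : κ ≃ κ') :
    (T.map e).Separates lo hi η := by
  intro φ
  rw [prob_map]
  exact h φ

/-! ### Error reduction by majority vote. -/

section Majority

/-- Majority vote over `L` independent clocks. -/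
def majority (T : PhaseTest κ) (L : ℕ) : PhaseTest (Fin L → κ) where
  prep b := ∏ i, T.prep (b i)
  prep_unit := by
    simp only [norm_prod, ← Finset.prod_pow]
    rw [← Fintype.prod_sum (fun (_ : Fin L) b => ‖T.prep b‖ ^ 2)]
    simp [T.prep_unit]
  time b := ∑ i, T.time (b i)
  readout := Matrix.of fun j b => ∏ i, T.readout (j i) (b i)
  readout_mem := by
    have h := Matrix.mem_unitaryGroup_iff.1 T.readout_mem
    rw [Matrix.mem_unitaryGroup_iff]
    ext j l
    have hjl : ∀ i, ∑ b, T.readout (j i) b * star (T.readout (l i) b)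
        = if j i = l i then 1 else 0 := by
      intro i
      have := congrFun (congrFun h (j i)) (l i)
      rwa [Matrix.mul_apply, Matrix.one_apply] at this
    rw [Matrix.mul_apply]
    simp only [Matrix.star_apply, Matrix.of_apply, star_prod, ← Finset.prod_mul_distrib]
    rw [← Fintype.prod_sum (fun i b => T.readout (j i) b * star (T.readout (l i) b))]
    simp only [hjl, Matrix.one_apply]
    by_cases hj : j = l
    · subst hj; simp
    · rw [if_neg hj]
      obtain ⟨i, hi⟩ := Function.ne_iff.1 hj
      exact Finset.prod_eq_zero (Finset.mem_univ i) (if_neg hi)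
  accept j := decide (L ≤ 2 * (Finset.univ.filter fun i => T.accept (j i) = true).card)

theorem amp_majority (T : PhaseTest κ) (L : ℕ) (φ : ℝ) (j : Fin L → κ) :
    (T.majority L).amp φ j = ∏ i, T.amp φ (j i) := by
  simp only [amp, majority, Matrix.of_apply]
  rw [Fintype.prod_sum]
  refine Finset.sum_congr rfl fun b _ => ?_
  rw [Finset.prod_mul_distrib, Finset.prod_mul_distrib, ← Complex.exp_sum]
  push_cast
  rw [Finset.sum_mul, Finset.sum_mul]

/-- Markov's inequality for the number of bad outcomes among independent ones. -/
theorem sum_prod_le_of_half_bad {p : κ → ℝ} (hp : ∀ j, 0 ≤ p j) (hp1 : ∑ j, p j = 1)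
    (bad : κ → Prop) [DecidablePred bad] (hq : ∑ j, (if bad j then p j else 0) ≤ 1 / 16)
    (L : ℕ) (S : (Fin L → κ) → Prop) [DecidablePred S]
    (hS : ∀ j, S j → L ≤ 2 * (Finset.univ.filter fun i => bad (j i)).card) :
    ∑ j : Fin L → κ, (if S j then ∏ i, p (j i) else 0) ≤ (1 / 2) ^ L := by
  -- The weight is 4 per bad outcome and 1/4 per good one; its product is at least 1 once half of
  -- the outcomes are bad.
  have h1 : ∀ j : Fin L → κ, (if S j then ∏ i, p (j i) else 0)
      ≤ ∏ i, p (j i) * (if bad (j i) then 4 else 1 / 4) := by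
    intro j
    have hnn : 0 ≤ ∏ i, p (j i) := Finset.prod_nonneg fun i _ => hp _
    rw [Finset.prod_mul_distrib]
    split_ifs with h
    · refine le_mul_of_one_le_right hnn ?_
      rw [Finset.prod_ite, Finset.prod_const, Finset.prod_const]
      have hc := Finset.card_filter_add_card_filter_not (s := (Finset.univ : Finset (Fin L)))
        (fun i => bad (j i))
      rw [Finset.card_univ, Fintype.card_fin] at hc
      have := hS j h
      obtain ⟨d, hd⟩ := Nat.exists_eq_add_of_le (show
        (Finset.univ.filter fun i => ¬ bad (j i)).card
          ≤ (Finset.univ.filter fun i => bad (j i)).card by omega)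
      rw [hd, pow_add, mul_right_comm, ← mul_pow]
      norm_num
      exact one_le_pow₀ (by norm_num)
    · exact mul_nonneg hnn (Finset.prod_nonneg fun i _ => by split_ifs <;> norm_num)
  refine (Finset.sum_le_sum fun j _ => h1 j).trans ?_
  rw [← Fintype.prod_sum (fun (_ : Fin L) j => p j * (if bad j then 4 else 1 / 4))]
  rw [Finset.prod_const, Finset.card_univ, Fintype.card_fin]
  -- The expected weight of one outcome is `1/4 + 15/4 * q ≤ 31/64 < 1/2` for bad mass `q ≤ 1/16`.
  have h2 : ∑ j, p j * (if bad j then (4 : ℝ) else 1 / 4)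
      = 1 / 4 * ∑ j, p j + 15 / 4 * ∑ j, (if bad j then p j else 0) := by
    rw [Finset.mul_sum, Finset.mul_sum, ← Finset.sum_add_distrib]
    refine Finset.sum_congr rfl fun j _ => ?_
    split_ifs <;> ring
  refine pow_le_pow_left₀ (Finset.sum_nonneg fun j _ => mul_nonneg (hp j) ?_) ?_ L
  · split_ifs <;> norm_num
  · rw [h2, hp1]; linarith

theorem Separates.majority {T : PhaseTest κ} {lo hi : ℝ} (h : T.Separates lo hi (1 / 16))
    (L : ℕ) : (T.majority L).Separates lo hi ((1 / 2) ^ L) := by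
  intro φ
  have hn : ∀ j, ‖(T.majority L).amp φ j‖ ^ 2 = ∏ i, ‖T.amp φ (j i)‖ ^ 2 := by
    intro j
    rw [amp_majority, norm_prod, Finset.prod_pow]
  have hrej : ∀ {μ : Type _} [Fintype μ] [DecidableEq μ] (T : PhaseTest μ),
      ∑ j, (if T.accept j = false then ‖T.amp φ j‖ ^ 2 else 0) = 1 - T.prob φ := by
    intro μ _ _ T
    rw [← T.sum_norm_sq_amp φ, prob, ← Finset.sum_sub_distrib]
    refine Finset.sum_congr rfl fun j _ => ?_
    cases T.accept j <;> simp
  have hp := fun j => sq_nonneg ‖T.amp φ j‖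
  constructor
  · intro hlo
    rw [prob]
    simp only [hn]
    exact sum_prod_le_of_half_bad hp (T.sum_norm_sq_amp φ) (fun j => T.accept j = true)
      ((h φ).1 hlo) L _ fun j hj => of_decide_eq_true hj
  · intro hhi
    suffices 1 - (T.majority L).prob φ ≤ (1 / 2) ^ L by linarith
    rw [← hrej]
    simp only [hn]
    refine sum_prod_le_of_half_bad hp (T.sum_norm_sq_amp φ) (fun j => T.accept j = false)
      (by rw [hrej]; linarith [(h φ).2 hhi]) L _ fun j hj => ?_
    have hj := of_decide_eq_false hj
    have hc := Finset.card_filter_add_card_filter_not (s := (Finset.univ : Finset (Fin L)))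
        (fun i => T.accept (j i) = true)
    rw [Finset.card_univ, Fintype.card_fin] at hc
    simp only [Bool.not_eq_true] at hc
    omega

end Majority

/-! ### Phase estimation with a tent-shaped window. -/

section Tent

variable (M : ℕ) [NeZero M]

/-- The discrete Fourier transform. -/
noncomputable def dftMatrix : Matrix (ZMod M) (ZMod M) ℂ :=
  Matrix.of fun j b => ZMod.stdAddChar (j * b) / (√M : ℝ)

theorem dftMatrix_mem : dftMatrix M ∈ Matrix.unitaryGroup (ZMod M) ℂ := by
  rw [Matrix.mem_unitaryGroup_iff]
  ext j l
  have hM : ((√M : ℝ) : ℂ) * (√M : ℝ) = M := by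
    rw [← Complex.ofReal_mul, Real.mul_self_sqrt (by positivity)]; simp
  have hM0 : (M : ℂ) ≠ 0 := by exact_mod_cast NeZero.ne M
  have h : ∀ b : ZMod M, ZMod.stdAddChar (j * b) / (√M : ℝ) *
      star (ZMod.stdAddChar (l * b) / ((√M : ℝ) : ℂ)) = ZMod.stdAddChar (b * (j - l)) / M := by
    intro b
    rw [star_div₀, Complex.star_def, Complex.conj_ofReal, ← AddChar.map_neg_eq_conj,
      div_mul_div_comm, hM, ← AddChar.map_add_eq_mul]
    congr 2; ring
  rw [Matrix.mul_apply]
  simp only [Matrix.star_apply, dftMatrix, Matrix.of_apply, h]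
  rw [← Finset.sum_div, AddChar.sum_mulShift _ (ZMod.isPrimitive_stdAddChar M), Matrix.one_apply]
  by_cases hjl : j = l
  · subst hjl; simp [hM0, ZMod.card]
  · simp [hjl, sub_eq_zero]

/-- The tent function. -/
def tent (b : ZMod M) : ℕ := min b.val (M - b.val)

theorem sum_val_eq_sum_range (f : ℕ → ℝ) : ∑ b : ZMod M, f b.val = ∑ k ∈ Finset.range M, f k := by
  cases M with
  | zero => exact absurd rfl (NeZero.ne 0)
  | succ n => exact Fin.sum_univ_eq_sum_range f (n + 1)

/-- The tent is at least `q = M / 4` on the middle half, which has `2 * q` points. -/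
theorem le_sum_tent_sq {q : ℕ} (hq : M = 4 * q) :
    (M : ℝ) ^ 3 / 32 ≤ ∑ b : ZMod M, (tent M b : ℝ) ^ 2 := by
  have h := sum_val_eq_sum_range M fun k => ((min k (M - k) : ℕ) : ℝ) ^ 2
  refine le_trans ?_ h.ge
  have hsub : Finset.Ico q (3 * q) ⊆ Finset.range M := fun k hk => by
    rw [Finset.mem_Ico] at hk
    rw [Finset.mem_range]; omega
  refine le_trans ?_ (Finset.sum_le_sum_of_subset_of_nonneg hsub fun _ _ _ => by positivity)
  have hcard : (M : ℝ) ^ 3 / 32 = ∑ k ∈ Finset.Ico q (3 * q), (q : ℝ) ^ 2 := by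
    rw [Finset.sum_const, Nat.card_Ico, show 3 * q - q = 2 * q by omega, hq]
    push_cast
    simp
    ring
  rw [hcard]
  refine Finset.sum_le_sum fun k hk => ?_
  rw [Finset.mem_Ico] at hk
  have : q ≤ min k (M - k) := by omega
  gcongr

theorem val_add_one_eq (b : ZMod M) :
    (b + 1).val = b.val + 1 ∨ ((b + 1).val = 0 ∧ b.val + 1 = M) := by
  have hb := ZMod.val_lt b
  rw [ZMod.val_add, ZMod.val_one_eq_one_mod, Nat.add_mod_mod]
  rcases (Nat.succ_le_of_lt hb).lt_or_eq with h | h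
  · exact Or.inl (Nat.mod_eq_of_lt h)
  · right; rw [← Nat.succ_eq_add_one, h]; simp

theorem sum_tent_sq_pos {q : ℕ} (hq : M = 4 * q) : 0 < ∑ b : ZMod M, (tent M b : ℝ) ^ 2 := by
  have : 0 < (M : ℝ) := by exact_mod_cast NeZero.pos M
  exact lt_of_lt_of_le (by positivity) (le_sum_tent_sq M hq)

/-- Phase estimation with a tent-shaped window, accepting the outcomes `j` for which the estimate
`‖1 - exp (2 π i j / M)‖ / 2` of `|sin (φ / 2)|` is at least `thr`. -/
noncomputable def tentTest {q : ℕ} (hq : M = 4 * q) (thr : ℝ) : PhaseTest (ZMod M) where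
  prep b := ((tent M b / √(∑ b : ZMod M, (tent M b : ℝ) ^ 2) : ℝ) : ℂ)
  prep_unit := by
    have h := sum_tent_sq_pos M hq
    simp only [Complex.norm_real, Real.norm_eq_abs, sq_abs, div_pow, Real.sq_sqrt h.le]
    rw [← Finset.sum_div, div_self h.ne']
  time b := b.val
  readout := dftMatrix M
  readout_mem := dftMatrix_mem M
  accept j := decide (thr ≤ ‖1 - (ZMod.stdAddChar j : ℂ)‖ / 2)

/-- Multiplying the Fourier transform by the character is a shift of the clock state, so the
weighted amplitudes are the transform of a twisted difference of that state. By Parseval the moment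
is bounded by the energy of the discrete derivative of the tent, which is 1-Lipschitz on the cycle.
-/
theorem tentTest_moment {q : ℕ} (hq : M = 4 * q) (thr φ : ℝ) :
    ∑ j, ‖(tentTest M hq thr).amp φ j‖ ^ 2 *
      (‖1 - (ZMod.stdAddChar j : ℂ)‖ / 2 - |Real.sin (φ / 2)|) ^ 2 ≤ 8 / (M : ℝ) ^ 2 := by
  set s : ℝ := ∑ b : ZMod M, (tent M b : ℝ) ^ 2 with hs
  have hs0 : 0 < s := sum_tent_sq_pos M hq
  have hM : 0 < (M : ℝ) := by exact_mod_cast NeZero.pos M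
  set T := tentTest M hq thr
  set z : ℂ := Complex.exp (φ * Complex.I) with hz
  have hz1 : ‖z‖ = 1 := Complex.norm_exp_ofReal_mul_I φ
  have hz0 : z ≠ 0 := Complex.exp_ne_zero _
  set v : ZMod M → ℂ := fun b => T.prep b * z ^ b.val with hv
  set d : ZMod M → ℂ := fun b => v (b - 1) - z⁻¹ * v b with hd
  have hamp : ∀ j, T.amp φ j = (dftMatrix M *ᵥ v) j := by
    intro j
    refine Finset.sum_congr rfl fun b _ => ?_
    simp only [hv, hz, ← Complex.exp_nat_mul, mul_assoc]
    rfl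
  have hshift : ∀ j, ((ZMod.stdAddChar j : ℂ) - z⁻¹) * T.amp φ j = (dftMatrix M *ᵥ d) j := by
    intro j
    have h1 : (ZMod.stdAddChar j : ℂ) * (dftMatrix M *ᵥ v) j
        = (dftMatrix M *ᵥ fun b => v (b - 1)) j := by
      simp only [mulVec, dotProduct, dftMatrix, Matrix.of_apply]
      rw [Finset.mul_sum]
      conv_rhs => rw [← Equiv.sum_comp (Equiv.addRight (1 : ZMod M))]
      refine Finset.sum_congr rfl fun b _ => ?_
      simp only [Equiv.coe_addRight, add_sub_cancel_right]
      rw [mul_add, mul_one, AddChar.map_add_eq_mul]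
      ring
    have h2 : d = (fun b => v (b - 1)) - z⁻¹ • v := rfl
    rw [h2, mulVec_sub, mulVec_smul, Pi.sub_apply, Pi.smul_apply, ← h1, hamp, smul_eq_mul, sub_mul]
  have hdn : ∀ b, ‖d (b + 1)‖ ^ 2 ≤ 1 / s := by
    intro b
    have hprep : ∀ b, T.prep b = ((tent M b / √s : ℝ) : ℂ) := fun b => rfl
    have hsq : 0 < √s := Real.sqrt_pos.2 hs0
    suffices ‖d (b + 1)‖ ≤ 1 / √s by
      calc ‖d (b + 1)‖ ^ 2 ≤ (1 / √s) ^ 2 := by gcongr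
        _ = 1 / s := by rw [div_pow, Real.sq_sqrt hs0.le, one_pow]
    rw [hd]
    simp only [add_sub_cancel_right, hv, hprep]
    rcases val_add_one_eq M b with h | ⟨h, h'⟩
    · have e : ((tent M b / √s : ℝ) : ℂ) * z ^ b.val
          - z⁻¹ * (((tent M (b + 1) / √s : ℝ) : ℂ) * z ^ (b + 1).val)
          = (((tent M b - tent M (b + 1)) / √s : ℝ) : ℂ) * z ^ b.val := by
        rw [h, pow_succ]
        push_cast
        field_simp
      rw [e, norm_mul, norm_pow, hz1, one_pow, mul_one, Complex.norm_real, Real.norm_eq_abs,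
        abs_div, abs_of_pos hsq]
      gcongr
      rw [tent, tent, h, abs_le]
      have hb := ZMod.val_lt b
      have h1 : min b.val (M - b.val) ≤ min (b.val + 1) (M - (b.val + 1)) + 1 := by omega
      have h2 : min (b.val + 1) (M - (b.val + 1)) ≤ min b.val (M - b.val) + 1 := by omega
      have h1' : ((min b.val (M - b.val) : ℕ) : ℝ)
          ≤ (min (b.val + 1) (M - (b.val + 1)) : ℕ) + 1 := by exact_mod_cast h1
      have h2' : ((min (b.val + 1) (M - (b.val + 1)) : ℕ) : ℝ)
          ≤ (min b.val (M - b.val) : ℕ) + 1 := by exact_mod_cast h2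
      constructor <;> linarith
    -- At the wrap-around the phases do not match, because `z ^ M` need not be 1; this is harmless
    -- since the tent vanishes at 0.
    · have h0 : tent M (b + 1) = 0 := by simp [tent, h]
      have h1 : (tent M b : ℝ) ≤ 1 := by
        have : tent M b ≤ 1 := by rw [tent]; omega
        exact_mod_cast this
      rw [h0]
      simp only [Nat.cast_zero, zero_div, Complex.ofReal_zero, zero_mul, mul_zero, sub_zero]
      rw [norm_mul, norm_pow, hz1, one_pow, mul_one, Complex.norm_real, Real.norm_eq_abs,
        abs_of_nonneg (by positivity)]
      gcongr
  have hsin : ‖1 - z⁻¹‖ = 2 * |Real.sin (φ / 2)| := by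
    have := Complex.norm_exp_I_mul_ofReal_sub_one φ
    rw [mul_comm, ← hz, norm_mul, Real.norm_eq_abs, Real.norm_eq_abs, abs_two] at this
    rw [← this, show 1 - z⁻¹ = z⁻¹ * (z - 1) by field_simp, norm_mul, norm_inv, hz1, inv_one,
      one_mul]
  calc ∑ j, ‖T.amp φ j‖ ^ 2 * (‖1 - (ZMod.stdAddChar j : ℂ)‖ / 2 - |Real.sin (φ / 2)|) ^ 2
      ≤ ∑ j, ‖(dftMatrix M *ᵥ d) j‖ ^ 2 / 4 := by
        refine Finset.sum_le_sum fun j _ => ?_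
        rw [← hshift, norm_mul, mul_pow, mul_comm, mul_div_right_comm]
        refine mul_le_mul_of_nonneg_right ?_ (by positivity)
        -- Comparing distances to 1 makes the estimate blind to the sign of `φ`, as it must be for
        -- the phases `±φ`.
        have h := abs_norm_sub_norm_le (1 - (ZMod.stdAddChar j : ℂ)) (1 - z⁻¹)
        rw [hsin, sub_sub_sub_cancel_left, norm_sub_rev z⁻¹] at h
        have h' := sq_le_sq' (abs_le.1 h).1 (abs_le.1 h).2
        nlinarith [h']
    _ = (∑ b, ‖d (b + 1)‖ ^ 2) / 4 := by
        rw [← Finset.sum_div, sum_norm_sq_mulVec (dftMatrix_mem M),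
          ← Equiv.sum_comp (Equiv.addRight (1 : ZMod M))]
        rfl
    _ ≤ (∑ b : ZMod M, 1 / s) / 4 := by
        gcongr with b
        exact hdn b
    _ = M / s / 4 := by
        rw [Finset.sum_const, Finset.card_univ, ZMod.card, nsmul_eq_mul]; ring
    _ ≤ M / ((M : ℝ) ^ 3 / 32) / 4 := by
        gcongr
        exact le_sum_tent_sq M hq
    _ = 8 / (M : ℝ) ^ 2 := by field_simp; norm_num

/-- Chebyshev's inequality: with the threshold at the midpoint, a wrong verdict requires an estimate
that is off by at least half the gap. -/
theorem tentTest_separates {q : ℕ} (hq : M = 4 * q) {lo hi : ℝ} (h : lo < hi) :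
    (tentTest M hq ((lo + hi) / 2)).Separates lo hi (32 / (M * (hi - lo)) ^ 2) := by
  intro φ
  have hM : 0 < (M : ℝ) := by exact_mod_cast NeZero.pos M
  set T := tentTest M hq ((lo + hi) / 2) with hT
  have hm := tentTest_moment M hq ((lo + hi) / 2) φ
  have hgap : 0 < hi - lo := sub_pos.2 h
  have key : ∀ S : ZMod M → Prop, [DecidablePred S] → (∀ j, S j → ((hi - lo) / 2) ^ 2 ≤
      (‖1 - (ZMod.stdAddChar j : ℂ)‖ / 2 - |Real.sin (φ / 2)|) ^ 2) →
      ∑ j, (if S j then ‖T.amp φ j‖ ^ 2 else 0) ≤ 32 / (M * (hi - lo)) ^ 2 := by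
    intro S _ hS
    have h1 : (∑ j, (if S j then ‖T.amp φ j‖ ^ 2 else 0)) * ((hi - lo) / 2) ^ 2
        ≤ 8 / (M : ℝ) ^ 2 := by
      refine le_trans ?_ hm
      rw [Finset.sum_mul]
      refine Finset.sum_le_sum fun j _ => ?_
      split_ifs with hj
      · exact mul_le_mul_of_nonneg_left (hS j hj) (by positivity)
      · rw [zero_mul]; positivity
    rw [← le_div_iff₀ (by positivity)] at h1
    refine h1.trans_eq ?_
    field_simp
    norm_num
  constructor
  · intro hlo
    refine key (fun j => T.accept j = true) fun j hj => ?_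
    have hj : (lo + hi) / 2 ≤ _ := of_decide_eq_true hj
    exact pow_le_pow_left₀ (by linarith) (by linarith) 2
  · intro hhi
    have h2 := key (fun j => T.accept j = false) fun j hj => by
      have hj : ¬ (lo + hi) / 2 ≤ _ := of_decide_eq_false hj
      rw [← neg_sq (_ - _)]
      exact pow_le_pow_left₀ (by linarith) (by linarith) 2
    have h3 : ∑ j, (if T.accept j = false then ‖T.amp φ j‖ ^ 2 else 0) = 1 - T.prob φ := by
      rw [← T.sum_norm_sq_amp φ, prob, ← Finset.sum_sub_distrib]
      refine Finset.sum_congr rfl fun j _ => ?_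
      cases T.accept j <;> simp
    linarith

end Tent

/-- A clock of `r` qubits resolves gaps of order `2 ^ (-r)`. -/
theorem exists_separates {r : ℕ} (hr : 2 ≤ r) {lo hi : ℝ} (h : lo < hi) :
    ∃ T : PhaseTest (Fin r → Bool), (∀ b, T.time b ≤ 2 ^ r) ∧
      T.Separates lo hi (32 / (2 ^ r * (hi - lo)) ^ 2) := by
  have hq : 2 ^ r = 4 * 2 ^ (r - 2) := by
    rw [show 4 = 2 ^ 2 by norm_num, ← pow_add]; congr 1; omega
  -- Any labelling will do, since oracle-free unitaries cost nothing.
  have e : ZMod (2 ^ r) ≃ (Fin r → Bool) := Fintype.equivOfCardEq (by simp [ZMod.card])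
  refine ⟨(tentTest (2 ^ r) hq ((lo + hi) / 2)).map e, fun b => (ZMod.val_lt _).le, ?_⟩
  have := (tentTest_separates (2 ^ r) hq h).map e
  push_cast at this
  exact this

/-- A clock of `L * r` qubits resolves gaps of order `2 ^ (-r)` up to the error `2 ^ (-L)`. -/
theorem exists_separates_majority {r : ℕ} (hr : 2 ≤ r) (L : ℕ) {lo hi : ℝ} (h : lo < hi)
    (hgap : 32 / (2 ^ r * (hi - lo)) ^ 2 ≤ 1 / 16) :
    ∃ T : PhaseTest (Fin (L * r) → Bool), (∀ b, T.time b ≤ L * 2 ^ r) ∧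
      T.Separates lo hi ((1 / 2) ^ L) := by
  obtain ⟨T, hT, hs⟩ := exists_separates hr h
  have hs' : T.Separates lo hi (1 / 16) := fun φ =>
    ⟨fun h => ((hs φ).1 h).trans hgap, fun h => le_trans (by linarith) ((hs φ).2 h)⟩
  let e : (Fin L → Fin r → Bool) ≃ (Fin (L * r) → Bool) :=
    (Equiv.curry _ _ _).symm.trans (finProdFinEquiv.arrowCongr (Equiv.refl Bool))
  refine ⟨(T.majority L).map e, fun b => ?_, (hs'.majority L).map e⟩
  calc ∑ i, T.time (e.symm b i) ≤ ∑ _i : Fin L, 2 ^ r := Finset.sum_le_sum fun i _ => hT _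
    _ = L * 2 ^ r := by simp

end PhaseTest

/-! ### Circuits and their query counts. -/

open Matrix Kronecker

section Circuits

variable {n a N : ℕ}

theorem onWires_conjTranspose (e : Fin n ⊕ Fin a ↪ Fin N)
    (M : Matrix (BitString n × BitString a) (BitString n × BitString a) ℂ) :
    (onWires e M)ᴴ = onWires e Mᴴ := by
  ext y z
  simp only [onWires, conjTranspose_apply, Matrix.of_apply, eq_comm (a := y _)]
  split_ifs <;> simp

/-- The inverse of a step. -/
def QueryStep.inv : QueryStep n a N → QueryStep n a N
  | .free U => .free U⁻¹
  | .query e => .queryInv e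
  | .queryInv e => .query e

theorem QueryStep.cost_inv (s : QueryStep n a N) : s.inv.cost = s.cost := by
  cases s <;> rfl

theorem QueryStep.toMatrix_inv (s : QueryStep n a N) (O : DistOracle n a) :
    s.inv.toMatrix O = (s.toMatrix O)ᴴ := by
  cases s with
  | free U => rfl
  | query e => exact (onWires_conjTranspose e _).symm
  | queryInv e =>
    rw [QueryStep.toMatrix, onWires_conjTranspose, conjTranspose_conjTranspose]
    rfl

variable {Ω : Type*} [Fintype Ω] [DecidableEq Ω]

/-- The oracle-dependent operator `U` on a register, embedded by `ι` into `N` qubits, can be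
performed with `q` queries. -/
def Realizes (ι : Matrix Ω Ω ℂ →⋆* Matrix (BitString N) (BitString N) ℂ) (q : ℕ)
    (U : DistOracle n a → Matrix Ω Ω ℂ) : Prop :=
  ∃ l : List (QueryStep n a N), (l.map QueryStep.cost).sum = q ∧
    ∀ O, (l.map fun s => s.toMatrix O).reverse.prod = ι (U O)

variable {ι : Matrix Ω Ω ℂ →⋆* Matrix (BitString N) (BitString N) ℂ}

theorem Realizes.mul {q q' : ℕ} {U U' : DistOracle n a → Matrix Ω Ω ℂ} (h : Realizes ι q U)
    (h' : Realizes ι q' U') : Realizes ι (q + q') fun O => U O * U' O := by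
  obtain ⟨l, hl, hU⟩ := h
  obtain ⟨l', hl', hU'⟩ := h'
  refine ⟨l' ++ l, ?_, fun O => ?_⟩
  · rw [List.map_append, List.sum_append, hl, hl', add_comm]
  · rw [List.map_append, List.reverse_append, List.prod_append, hU, hU', map_mul]

theorem Realizes.conjTranspose {q : ℕ} {U : DistOracle n a → Matrix Ω Ω ℂ} (h : Realizes ι q U) :
    Realizes ι q fun O => (U O)ᴴ := by
  obtain ⟨l, hl, hU⟩ := h
  refine ⟨(l.map QueryStep.inv).reverse, ?_, fun O => ?_⟩
  · rw [List.map_reverse, List.sum_reverse, List.map_map, ← hl]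
    congr 1
    exact List.map_congr_left fun s _ => s.cost_inv
  · rw [List.map_reverse, List.reverse_reverse, List.map_map]
    refine Eq.trans ?_ (map_star ι (U O)).symm
    rw [← hU, star_eq_conjTranspose, conjTranspose_list_prod, List.map_reverse, List.reverse_reverse,
      List.map_map]
    congr 1
    exact List.map_congr_left fun s _ => s.toMatrix_inv O

theorem Realizes.free {U : Matrix Ω Ω ℂ} (hU : U ∈ Matrix.unitaryGroup Ω ℂ) :
    Realizes (n := n) (a := a) ι 0 fun _ => U := by
  have h : ι U ∈ Matrix.unitaryGroup (BitString N) ℂ := by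
    rw [Matrix.mem_unitaryGroup_iff, ← map_star, ← map_mul, Matrix.mem_unitaryGroup_iff.1 hU,
      map_one]
  exact ⟨[.free ⟨ι U, h⟩], rfl, fun O => by simp [QueryStep.toMatrix]⟩

theorem blockDiagonal_mem {β Z : Type*} [Fintype β] [DecidableEq β] [Fintype Z] [DecidableEq Z]
    {M : Z → Matrix β β ℂ} (h : ∀ z, M z ∈ Matrix.unitaryGroup β ℂ) :
    blockDiagonal M ∈ Matrix.unitaryGroup (β × Z) ℂ := by
  rw [Matrix.mem_unitaryGroup_iff, star_eq_conjTranspose, blockDiagonal_conjTranspose,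
    ← blockDiagonal_mul, ← blockDiagonal_one]
  congr 1
  ext1 z
  exact Matrix.mem_unitaryGroup_iff.1 (h z)

variable {β Z : Type*} [Fintype β] [DecidableEq β] [Fintype Z] [DecidableEq Z]

/-- Powers of Grover iterates, with the exponent and the marked subspace controlled by a second
register. -/
theorem Realizes.controlled_groverIterate
    {ι : Matrix (β × Z) (β × Z) ℂ →⋆* Matrix (BitString N) (BitString N) ℂ}
    {B : DistOracle n a → Matrix β β ℂ} (hB : ∀ O, B O ∈ Matrix.unitaryGroup β ℂ) {q : ℕ}
    (h : Realizes ι q fun O => B O ⊗ₖ (1 : Matrix Z Z ℂ)) (y₀ : β) (mark : Z → β → Prop)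
    [∀ z, DecidablePred (mark z)] {k : Z → ℕ} {K : ℕ} (hk : ∀ z, k z ≤ K) :
    Realizes ι (K * (2 * q)) fun O =>
      blockDiagonal fun z => groverIterate (B O) y₀ (mark z) ^ k z := by
  -- Round `t` is active where `t < k z`. Only the oracle-free reflections are controlled; the
  -- queries are not, and with both reflections switched off the round collapses to `B * Bᴴ = 1`.
  have hstep : ∀ t : ℕ, Realizes ι (2 * q) fun O =>
      blockDiagonal fun z => if t < k z then groverIterate (B O) y₀ (mark z) else 1 := by
    intro t
    have h1 : Realizes (n := n) (a := a) ι 0 fun _ =>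
        blockDiagonal fun z : Z => if t < k z then phaseFlip (· ≠ y₀) else 1 :=
      Realizes.free <| blockDiagonal_mem fun z => by
        split_ifs; exacts [phaseFlip_mem _, one_mem _]
    have h2 : Realizes (n := n) (a := a) ι 0 fun _ =>
        blockDiagonal fun z : Z => if t < k z then phaseFlip (mark z) else 1 :=
      Realizes.free <| blockDiagonal_mem fun z => by
        split_ifs; exacts [phaseFlip_mem _, one_mem _]
    convert ((h.mul h1).mul h.conjTranspose).mul h2 using 1
    · omega
    · funext O
      rw [kronecker_one, blockDiagonal_conjTranspose, ← blockDiagonal_mul, ← blockDiagonal_mul,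
        ← blockDiagonal_mul]
      congr 1
      funext z
      split_ifs
      · rfl
      · rw [mul_one, mul_one]
        exact (Matrix.mem_unitaryGroup_iff.1 (hB O)).symm
  have hall : ∀ t : ℕ, Realizes ι (t * (2 * q)) fun O =>
      blockDiagonal fun z => groverIterate (B O) y₀ (mark z) ^ min (k z) t := by
    intro t
    induction t with
    | zero =>
      convert Realizes.free (n := n) (a := a) (ι := ι) (one_mem _) using 1
      · simp
      · funext O
        simp only [Nat.min_zero, pow_zero]
        exact blockDiagonal_one
    | succ t ih =>
      convert ih.mul (hstep t) using 1
      · ring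
      · funext O
        rw [← blockDiagonal_mul]
        congr 1
        funext z
        split_ifs with h
        · rw [min_eq_right h.le, min_eq_right (Nat.succ_le_of_lt h), pow_succ]
        · rw [min_eq_left (by omega), min_eq_left (by omega), mul_one]
  simpa only [min_eq_left (hk _)] using hall K

/-- The embedding of operators on the first register. -/
def tensorOne (β Z : Type*) [Fintype β] [DecidableEq β] [Fintype Z] [DecidableEq Z] :
    Matrix β β ℂ →⋆* Matrix (β × Z) (β × Z) ℂ where
  toFun M := M ⊗ₖ 1
  map_one' := one_kronecker_one
  map_mul' M M' := by rw [← mul_kronecker_mul, one_mul]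
  map_star' M := by
    rw [star_eq_conjTranspose, star_eq_conjTranspose, conjTranspose_kronecker, conjTranspose_one]

/-- Relabelling of the basis. -/
def reindexHom {Ω Ω' : Type*} [Fintype Ω] [DecidableEq Ω] [Fintype Ω'] [DecidableEq Ω']
    (E : Ω' ≃ Ω) : Matrix Ω Ω ℂ →⋆* Matrix Ω' Ω' ℂ where
  toFun M := M.submatrix E E
  map_one' := submatrix_one_equiv E
  map_mul' M M' := (submatrix_mul_equiv M M' E E E).symm
  map_star' _ := rfl

/-! ### Testing the mass of a marked subspace -/

variable {S κ : Type*} [Fintype S] [DecidableEq S] [Fintype κ] [DecidableEq κ]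

/-- The phase test `T` with prepared clock `P e_{b₀}`, run on the Grover iterate of `B`. The marked
subspace is controlled by a register `S`, which is prepared by `A`. -/
noncomputable def testCircuit (T : PhaseTest κ) (P : Matrix κ κ ℂ) (B : Matrix β β ℂ)
    (A : Matrix S S ℂ) (y₀ : β) (mark : S → β → Prop) [∀ s, DecidablePred (mark s)] :
    Matrix (β × (S × κ)) (β × (S × κ)) ℂ :=
  (1 ⊗ₖ (1 ⊗ₖ T.readout)) *
    (blockDiagonal fun z : S × κ => groverIterate B y₀ (mark z.1) ^ T.time z.2) *
    (B ⊗ₖ (A ⊗ₖ P))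

variable (T : PhaseTest κ) {P : Matrix κ κ ℂ} {y₀ : β} (mark : S → β → Prop)
  [∀ s, DecidablePred (mark s)]

theorem testCircuit_mem (hP : P ∈ Matrix.unitaryGroup κ ℂ) {B : Matrix β β ℂ}
    (hB : B ∈ Matrix.unitaryGroup β ℂ) {A : Matrix S S ℂ} (hA : A ∈ Matrix.unitaryGroup S ℂ) :
    testCircuit T P B A y₀ mark ∈ Matrix.unitaryGroup (β × (S × κ)) ℂ :=
  mul_mem (mul_mem
    (kronecker_mem_unitary (one_mem _) (kronecker_mem_unitary (one_mem _) T.readout_mem))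
    (blockDiagonal_mem fun z => pow_mem (groverIterate_mem y₀ (mark z.1) hB) _))
    (kronecker_mem_unitary hB (kronecker_mem_unitary hA hP))

theorem Realizes.testCircuit (hP : P ∈ Matrix.unitaryGroup κ ℂ)
    {ι : Matrix (β × (S × κ)) (β × (S × κ)) ℂ →⋆* Matrix (BitString N) (BitString N) ℂ}
    {B : DistOracle n a → Matrix β β ℂ} (hB : ∀ O, B O ∈ Matrix.unitaryGroup β ℂ)
    {A : DistOracle n a → Matrix S S ℂ} {q q' K : ℕ}
    (h : Realizes ι q fun O => B O ⊗ₖ (1 : Matrix (S × κ) (S × κ) ℂ))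
    (h' : Realizes ι q' fun O => (1 : Matrix β β ℂ) ⊗ₖ (A O ⊗ₖ (1 : Matrix κ κ ℂ)))
    (hK : ∀ b, T.time b ≤ K) :
    Realizes ι (q + q' + K * (2 * q)) fun O => testCircuit T P (B O) (A O) y₀ mark := by
  have h1 : Realizes (n := n) (a := a) ι 0 fun _ => 1 ⊗ₖ (1 ⊗ₖ T.readout) := Realizes.free
    (kronecker_mem_unitary (one_mem _) (kronecker_mem_unitary (one_mem _) T.readout_mem))
  have h2 : Realizes (n := n) (a := a) ι 0 fun _ => 1 ⊗ₖ (1 ⊗ₖ P) := Realizes.free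
    (kronecker_mem_unitary (one_mem _) (kronecker_mem_unitary (one_mem _) hP))
  have h3 := Realizes.controlled_groverIterate hB h y₀ (fun z : S × κ => mark z.1)
    (k := fun z => T.time z.2) fun z => hK z.2
  convert (h1.mul h3).mul ((h.mul h').mul h2) using 1
  · ring
  · funext O
    simp only [_root_.testCircuit, ← mul_kronecker_mul, one_mul, mul_one]

/-- After its preparation the register `S` acts only as a control, so its amplitude factors out and
each content `s` can be analysed separately. -/
theorem testCircuit_apply {s₀ : S} {b₀ : κ} (hP : ∀ b, P b b₀ = T.prep b) (B : Matrix β β ℂ)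
    (A : Matrix S S ℂ) (y : β) (s : S) (j : κ) :
    testCircuit T P B A y₀ mark (y, (s, j)) (y₀, (s₀, b₀)) = A s s₀ *
      ∑ b, T.readout j b * T.prep b *
        (groverIterate B y₀ (mark s) ^ T.time b *ᵥ fun y => B y y₀) y := by
  simp only [testCircuit, mul_assoc]
  rw [Matrix.mul_apply]
  simp only [kroneckerMap_apply, Matrix.one_apply, Fintype.sum_prod_type, Matrix.mul_apply,
    blockDiagonal_apply, ite_mul, zero_mul, one_mul, Finset.sum_ite_eq, Finset.mem_univ, if_true,
    mulVec, dotProduct, hP]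
  simp only [Finset.sum_ite_irrel, Finset.sum_const_zero, Finset.mul_sum]
  simp only [Finset.sum_ite_eq, Finset.mem_univ, if_true]
  refine Finset.sum_congr rfl fun b _ => Finset.sum_congr rfl fun i _ => ?_
  ring

/-- The accepted mass for a fixed content of the controlling register. -/
theorem sum_accept_testCircuit {s₀ : S} {b₀ : κ} (hP : ∀ b, P b b₀ = T.prep b) {B : Matrix β β ℂ}
    (hB : B ∈ Matrix.unitaryGroup β ℂ) (A : Matrix S S ℂ) (s : S) :
    ∑ y, ∑ j, (if T.accept j then
        ‖testCircuit T P B A y₀ mark (y, (s, j)) (y₀, (s₀, b₀))‖ ^ 2 else 0)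
      = ‖A s s₀‖ ^ 2 * ((T.prob (groverAngle B y₀ (mark s))
        + T.prob (-groverAngle B y₀ (mark s))) / 2) := by
  rw [Finset.sum_comm]
  simp only [PhaseTest.prob, ← Finset.sum_add_distrib, Finset.sum_div, Finset.mul_sum]
  refine Finset.sum_congr rfl fun j _ => ?_
  split_ifs
  · simp only [testCircuit_apply T mark hP, norm_mul, mul_pow]
    rw [← Finset.mul_sum, sum_norm_sq_orbit y₀ (mark s) hB]
    rfl
  · simp

theorem sum_accept_le {s₀ : S} {b₀ : κ} (hP : ∀ b, P b b₀ = T.prep b) {B : Matrix β β ℂ}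
    (hB : B ∈ Matrix.unitaryGroup β ℂ) (A : Matrix S S ℂ) {lo hi η : ℝ}
    (hT : T.Separates lo hi η) (s : S) (hlo : √(markedMass B y₀ (mark s)) ≤ lo) :
    ∑ y, ∑ j, (if T.accept j then
        ‖testCircuit T P B A y₀ mark (y, (s, j)) (y₀, (s₀, b₀))‖ ^ 2 else 0)
      ≤ ‖A s s₀‖ ^ 2 * η := by
  rw [← abs_sin_half_groverAngle y₀ (mark s) hB] at hlo
  rw [sum_accept_testCircuit T mark hP hB]
  have h1 := (hT _).1 hlo
  have h2 := (hT (-groverAngle B y₀ (mark s))).1 (by rwa [neg_div, Real.sin_neg, abs_neg])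
  exact mul_le_mul_of_nonneg_left (by linarith) (by positivity)

theorem le_sum_accept {s₀ : S} {b₀ : κ} (hP : ∀ b, P b b₀ = T.prep b) {B : Matrix β β ℂ}
    (hB : B ∈ Matrix.unitaryGroup β ℂ) (A : Matrix S S ℂ) {lo hi η : ℝ}
    (hT : T.Separates lo hi η) (s : S) (hhi : hi ≤ √(markedMass B y₀ (mark s))) :
    ‖A s s₀‖ ^ 2 * (1 - η) ≤ ∑ y, ∑ j, (if T.accept j then
        ‖testCircuit T P B A y₀ mark (y, (s, j)) (y₀, (s₀, b₀))‖ ^ 2 else 0) := by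
  rw [← abs_sin_half_groverAngle y₀ (mark s) hB] at hhi
  rw [sum_accept_testCircuit T mark hP hB]
  have h1 := (hT _).2 hhi
  have h2 := (hT (-groverAngle B y₀ (mark s))).2 (by rwa [neg_div, Real.sin_neg, abs_neg])
  exact mul_le_mul_of_nonneg_left (by linarith) (by positivity)

end Circuits

/-! ### Nesting the two tests on actual qubits. -/

section Assembly

variable {n a N c₁ c₂ : ℕ}

/-- The wires: two copies of the qubits of the oracle, a clock next to the second copy, the output
qubit, and another clock. -/
abbrev Wires (n a c₁ c₂ : ℕ) : Type :=
  (Fin n ⊕ Fin a) ⊕ ((Fin n ⊕ Fin a) ⊕ Fin c₁) ⊕ (Unit ⊕ Fin c₂)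

/-- The registers formed by the wires. -/
abbrev Registers (n a c₁ c₂ : ℕ) : Type :=
  ((BitString n × BitString a) × ((BitString n × BitString a) × BitString c₁)) ×
    (Bool × BitString c₂)

instance : DecidableEq (Registers n a c₁ c₂) :=
  @instDecidableEqProd _ _ (@instDecidableEqProd _ _ inferInstance inferInstance) inferInstance

/-- Splitting a bit string into the registers. -/
def splitRegisters (σ : Wires n a c₁ c₂ ≃ Fin N) : BitString N ≃ Registers n a c₁ c₂ where
  toFun y := (((fun i => y (σ (.inl (.inl i))), fun i => y (σ (.inl (.inr i)))),
    ((fun i => y (σ (.inr (.inl (.inl (.inl i))))), fun i => y (σ (.inr (.inl (.inl (.inr i)))))),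
      fun i => y (σ (.inr (.inl (.inr i)))))),
    (y (σ (.inr (.inr (.inl ())))), fun i => y (σ (.inr (.inr (.inr i))))))
  invFun ω := fun w => Sum.elim (Sum.elim ω.1.1.1 ω.1.1.2)
    (Sum.elim (Sum.elim (Sum.elim ω.1.2.1.1 ω.1.2.1.2) ω.1.2.2)
      (Sum.elim (fun _ => ω.2.1) ω.2.2)) (σ.symm w)
  left_inv y := by
    funext w
    obtain ⟨w, rfl⟩ := σ.surjective w
    rcases w with (w | w) | ((w | w) | w) | (w | w) <;> simp
  right_inv ω := by simp

/-- The wires of the first copy. -/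
def firstCopy (σ : Wires n a c₁ c₂ ≃ Fin N) : Fin n ⊕ Fin a ↪ Fin N :=
  Function.Embedding.inl.trans σ.toEmbedding

/-- The wires of the second copy. -/
def secondCopy (σ : Wires n a c₁ c₂ ≃ Fin N) : Fin n ⊕ Fin a ↪ Fin N :=
  ((Function.Embedding.inl.trans Function.Embedding.inl).trans Function.Embedding.inr).trans
    σ.toEmbedding

theorem onWires_firstCopy (σ : Wires n a c₁ c₂ ≃ Fin N)
    (M : Matrix (BitString n × BitString a) (BitString n × BitString a) ℂ) :
    onWires (firstCopy σ) M = reindexHom (splitRegisters σ) (tensorOne _ _ (M ⊗ₖ 1)) := by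
  ext y z
  have h : (∀ i, (∀ j, firstCopy σ j ≠ i) → y i = z i) ↔
      (splitRegisters σ y).1.2 = (splitRegisters σ z).1.2 ∧
        (splitRegisters σ y).2 = (splitRegisters σ z).2 := by
    rw [← σ.forall_congr_right]
    simp [firstCopy, splitRegisters, Sum.forall, Prod.ext_iff, funext_iff, and_assoc,
      Unique.forall_iff]
  have e : reindexHom (splitRegisters σ) (tensorOne _ _ (M ⊗ₖ 1)) y z
      = (M (readWires (firstCopy σ) y) (readWires (firstCopy σ) z) *
        (1 : Matrix _ _ ℂ) (splitRegisters σ y).1.2 (splitRegisters σ z).1.2) *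
        (1 : Matrix _ _ ℂ) (splitRegisters σ y).2 (splitRegisters σ z).2 := rfl
  rw [e, onWires, Matrix.of_apply, Matrix.one_apply, Matrix.one_apply]
  simp only [h, ite_and]
  split_ifs <;> simp

theorem onWires_secondCopy (σ : Wires n a c₁ c₂ ≃ Fin N)
    (M : Matrix (BitString n × BitString a) (BitString n × BitString a) ℂ) :
    onWires (secondCopy σ) M
      = reindexHom (splitRegisters σ) (tensorOne _ _ (1 ⊗ₖ (M ⊗ₖ 1))) := by
  ext y z
  have h : (∀ i, (∀ j, secondCopy σ j ≠ i) → y i = z i) ↔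
      (splitRegisters σ y).1.1 = (splitRegisters σ z).1.1 ∧
      (splitRegisters σ y).1.2.2 = (splitRegisters σ z).1.2.2 ∧
        (splitRegisters σ y).2 = (splitRegisters σ z).2 := by
    rw [← σ.forall_congr_right]
    simp [secondCopy, splitRegisters, Sum.forall, Prod.ext_iff, funext_iff, and_assoc,
      Unique.forall_iff]
  have e : reindexHom (splitRegisters σ) (tensorOne _ _ (1 ⊗ₖ (M ⊗ₖ 1))) y z
      = ((1 : Matrix _ _ ℂ) (splitRegisters σ y).1.1 (splitRegisters σ z).1.1 *
        (M (readWires (secondCopy σ) y) (readWires (secondCopy σ) z) *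
        (1 : Matrix _ _ ℂ) (splitRegisters σ y).1.2.2 (splitRegisters σ z).1.2.2)) *
        (1 : Matrix _ _ ℂ) (splitRegisters σ y).2 (splitRegisters σ z).2 := rfl
  rw [e, onWires, Matrix.of_apply, Matrix.one_apply, Matrix.one_apply, Matrix.one_apply]
  simp only [h, ite_and]
  split_ifs <;> simp

theorem finalState_eq (A : QueryAlgorithm n a N) (O : DistOracle n a) (y : BitString N) :
    A.finalState O y = (A.steps.map fun s => s.toMatrix O).reverse.prod y fun _ => false := by
  have h : ∀ (l : List (QueryStep n a N)) (v : BitString N → ℂ),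
      l.foldl (fun v s => (s.toMatrix O).mulVec v) v
        = (l.map fun s => s.toMatrix O).reverse.prod *ᵥ v := by
    intro l
    induction l with
    | nil => simp
    | cons s l ih => intro v; simp [ih, mulVec_mulVec]
  rw [QueryAlgorithm.finalState, h]
  simp

/-- Adds the acceptance bit of a clock to the output qubit. -/
def acceptFlip {X κ : Type*} (acc : κ → Bool) : X × (Bool × κ) ≃ X × (Bool × κ) where
  toFun ω := (ω.1, (xor ω.2.1 (acc ω.2.2), ω.2.2))
  invFun ω := (ω.1, (xor ω.2.1 (acc ω.2.2), ω.2.2))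
  left_inv ω := by simp
  right_inv ω := by simp

theorem submatrix_equiv_mem {Ω : Type*} [Fintype Ω] [DecidableEq Ω] {M : Matrix Ω Ω ℂ}
    (hM : M ∈ Matrix.unitaryGroup Ω ℂ) (f : Ω ≃ Ω) :
    M.submatrix f id ∈ Matrix.unitaryGroup Ω ℂ := by
  rw [Matrix.mem_unitaryGroup_iff, star_eq_conjTranspose, conjTranspose_submatrix,
    ← submatrix_mul _ _ _ _ _ Function.bijective_id, ← star_eq_conjTranspose,
    Matrix.mem_unitaryGroup_iff.1 hM, submatrix_one_equiv]

theorem markedMass_eq_outcomeProb (O : DistOracle n a) (x : BitString n) :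
    markedMass (O : Matrix (BitString n × BitString a) (BitString n × BitString a) ℂ)
      (fun _ => false, fun _ => false) (fun y => y.1 = x) = O.outcomeProb x := by
  rw [markedMass, DistOracle.outcomeProb, Fintype.sum_prod_type]
  rw [Finset.sum_eq_single x (by intro z _ hz; simp [hz]) (by simp)]
  simp

/-- Detection of an outcome of probability at least `hi ^ 2`, with the qubits and queries that it
takes. -/
theorem exists_detector (T₁ : PhaseTest (BitString c₁)) (T₂ : PhaseTest (BitString c₂))
    {K₁ K₂ : ℕ} (hK₁ : ∀ b, T₁.time b ≤ K₁) (hK₂ : ∀ b, T₂.time b ≤ K₂)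
    {lo hi η lo' hi' η' : ℝ} (hhi : 0 < hi) (hT₁ : T₁.Separates lo hi η) (hT₂ : T₂.Separates lo' hi' η')
    (hη1 : η ≤ 1) (hlo' : √η ≤ lo') (hhi' : hi' ≤ √(hi ^ 2 * (1 - η))) :
    ∃ A : QueryAlgorithm n a (2 * (n + a) + c₁ + c₂ + 1),
      A.queries = (2 + 2 * K₁) * (1 + 2 * K₂) ∧ ∀ O : DistOracle n a,
        ((∀ x, √(O.outcomeProb x) ≤ lo) → 1 - η' ≤ A.outputProb O false) ∧
        ((∃ x, hi ^ 2 ≤ O.outcomeProb x) →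
          1 - η' ≤ A.outputProb O true) := by
  obtain ⟨P₁, hP₁, hP₁'⟩ := exists_unitary_col (fun _ => false) T₁.prep T₁.prep_unit
  obtain ⟨P₂, hP₂, hP₂'⟩ := exists_unitary_col (fun _ => false) T₂.prep T₂.prep_unit
  set d₀ : BitString n × BitString a := (fun _ => false, fun _ => false) with hd₀
  have σ : Wires n a c₁ c₂ ≃ Fin (2 * (n + a) + c₁ + c₂ + 1) :=
    Fintype.equivFinOfCardEq (by simp; ring)
  let V : DistOracle n a → Matrix ((BitString n × BitString a) ×
      ((BitString n × BitString a) × BitString c₁)) _ ℂ := fun O =>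
    testCircuit T₁ P₁ O.1 O.1 d₀ fun d y => y.1 = d.1
  have hVmem : ∀ O, V O ∈ Matrix.unitaryGroup _ ℂ := fun O => testCircuit_mem T₁ _ hP₁ O.2 O.2
  let mark : Bool → (BitString n × BitString a) ×
      ((BitString n × BitString a) × BitString c₁) → Prop := fun _ x => T₁.accept x.2.2 = true
  -- The outer test treats the whole inner circuit as its state preparation. Its controlling
  -- register is the output qubit, which is left untouched and on which the marking does not depend.
  let U' : DistOracle n a → Matrix (Registers n a c₁ c₂) (Registers n a c₁ c₂) ℂ := fun O =>
    testCircuit T₂ P₂ (V O) 1 (d₀, (d₀, fun _ => false)) mark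
  have hU'mem : ∀ O, U' O ∈ Matrix.unitaryGroup _ ℂ := fun O =>
    testCircuit_mem T₂ _ hP₂ (hVmem O) (one_mem _)
  let ιX := (reindexHom (splitRegisters σ)).comp (tensorOne _ (Bool × BitString c₂))
  have hq₁ : Realizes ιX 1 fun O : DistOracle n a => O.1 ⊗ₖ 1 :=
    ⟨[.query (firstCopy σ)], rfl, fun O => by
      refine Eq.trans ?_ (onWires_firstCopy σ O.1)
      simp [QueryStep.toMatrix]⟩
  have hq₂ : Realizes ιX 1 fun O : DistOracle n a => 1 ⊗ₖ (O.1 ⊗ₖ 1) :=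
    ⟨[.query (secondCopy σ)], rfl, fun O => by
      refine Eq.trans ?_ (onWires_secondCopy σ O.1)
      simp [QueryStep.toMatrix]⟩
  have hV : Realizes ιX (1 + 1 + K₁ * (2 * 1)) V :=
    Realizes.testCircuit T₁ _ hP₁ (fun O => O.2) hq₁ hq₂ hK₁
  have hV' : Realizes (reindexHom (splitRegisters σ)) (1 + 1 + K₁ * (2 * 1)) fun O => V O ⊗ₖ 1 := hV
  have hU' : Realizes (reindexHom (splitRegisters σ)) _ U' :=
    Realizes.testCircuit T₂ mark hP₂ hVmem hV' (A := fun _ => 1)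
      (Realizes.free (kronecker_mem_unitary (one_mem _) (kronecker_mem_unitary (one_mem _)
        (one_mem _)))) hK₂
  have hF := Realizes.free (n := n) (a := a) (ι := reindexHom (splitRegisters σ))
    (submatrix_equiv_mem (one_mem _) (acceptFlip T₂.accept))
  obtain ⟨l, hl, hlU⟩ := hF.mul hU'
  refine ⟨⟨l, σ (.inr (.inr (.inl ())))⟩, ?_, fun O => ?_⟩
  · rw [QueryAlgorithm.queries, hl]; ring
  set ω₀ : Registers n a c₁ c₂ := ((d₀, (d₀, fun _ => false)), (false, fun _ => false)) with hω₀
  set A : QueryAlgorithm n a (2 * (n + a) + c₁ + c₂ + 1) := ⟨l, σ (.inr (.inr (.inl ())))⟩ with hA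
  have hfin : ∀ y, A.finalState O y
      = U' O (acceptFlip T₂.accept (splitRegisters σ y)) ω₀ := by
    intro y
    rw [finalState_eq, hlU]
    have h : (1 : Matrix (Registers n a c₁ c₂) (Registers n a c₁ c₂) ℂ).submatrix
        (acceptFlip T₂.accept) id * U' O = (U' O).submatrix (acceptFlip T₂.accept) id := by
      ext i j
      simp [Matrix.mul_apply, Matrix.one_apply]
    exact congrFun (congrFun h (splitRegisters σ y)) ω₀
  have hout : ∀ b, A.outputProb O b = ∑ ω : Registers n a c₁ c₂,
      if ω.2.1 = b then ‖U' O (acceptFlip T₂.accept ω) ω₀‖ ^ 2 else 0 := by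
    intro b
    rw [← Equiv.sum_comp (splitRegisters σ), QueryAlgorithm.outputProb]
    simp only [hfin]
    rfl
  have htotal : A.outputProb O false + A.outputProb O true = 1 := by
    rw [hout, hout, ← Finset.sum_add_distrib, ← sum_norm_sq_col ω₀ (hU'mem O)]
    refine Eq.trans ?_ (Equiv.sum_comp (acceptFlip T₂.accept) fun ω => ‖U' O ω ω₀‖ ^ 2)
    refine Finset.sum_congr rfl fun ω _ => ?_
    cases ω.2.1 <;> simp
  have htrue : A.outputProb O true = ∑ x, ∑ j,
      if T₂.accept j then ‖U' O (x, (false, j)) ω₀‖ ^ 2 else 0 := by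
    -- Before the final flip the output qubit is still in state 0, so afterwards it carries exactly
    -- the verdict of the outer clock.
    have h0 : ∀ x j, U' O (x, (true, j)) ω₀ = 0 := by
      intro x j
      rw [hω₀]
      simp only [U', testCircuit_apply T₂ mark hP₂']
      simp
    rw [hout, Fintype.sum_prod_type]
    refine Finset.sum_congr rfl fun x _ => ?_
    rw [Fintype.sum_prod_type, Fintype.sum_bool]
    simp only [acceptFlip, Equiv.coe_fn_mk, Bool.true_xor, if_true, Bool.false_eq_true, if_false,
      Finset.sum_const_zero, add_zero]
    refine Finset.sum_congr rfl fun j _ => ?_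
    cases T₂.accept j <;> simp [h0]
  have hmass : markedMass (V O) (d₀, (d₀, fun _ => false)) (mark false)
      = ∑ d, ∑ y, ∑ j, if T₁.accept j then
        ‖V O (y, (d, j)) (d₀, (d₀, fun _ => false))‖ ^ 2 else 0 := by
    rw [markedMass, Fintype.sum_prod_type]
    exact (Finset.sum_congr rfl fun y _ => Fintype.sum_prod_type _).trans Finset.sum_comm
  constructor
  · intro h
    -- Every content `d` is flagged with probability at most `η`, and the contents have total weight
    -- 1.
    have hm : markedMass (V O) (d₀, (d₀, fun _ => false)) (mark false) ≤ η := by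
      calc markedMass (V O) (d₀, (d₀, fun _ => false)) (mark false)
          ≤ ∑ d, ‖O.1 d d₀‖ ^ 2 * η := by
            rw [hmass]
            refine Finset.sum_le_sum fun d _ => sum_accept_le T₁ _ hP₁' O.2 O.1 hT₁ d ?_
            rw [markedMass_eq_outcomeProb]
            exact h d.1
        _ = η := by rw [← Finset.sum_mul, sum_norm_sq_col d₀ O.2, one_mul]
    have := sum_accept_le T₂ mark hP₂' (hVmem O) 1 hT₂ (s₀ := false) false
      ((Real.sqrt_le_sqrt hm).trans hlo')
    rw [htrue] at htotal
    simp only [Matrix.one_apply_eq, norm_one, one_pow, one_mul] at this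
    linarith
  · rintro ⟨x, hx⟩
    -- The heavy outcome alone contributes this much; the other outcomes, on which the inner test
    -- may be undecided, can only add mass.
    have hm : hi ^ 2 * (1 - η) ≤ markedMass (V O) (d₀, (d₀, fun _ => false)) (mark false) := by
      calc hi ^ 2 * (1 - η) ≤ O.outcomeProb x * (1 - η) :=
            mul_le_mul_of_nonneg_right hx (by linarith)
        _ = ∑ d : BitString n × BitString a,
              if d.1 = x then ‖O.1 d d₀‖ ^ 2 * (1 - η) else 0 := by
            rw [← markedMass_eq_outcomeProb, markedMass, Finset.sum_mul]
            simp only [ite_mul, zero_mul]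
            rfl
        _ ≤ _ := by
            rw [hmass]
            refine Finset.sum_le_sum fun d _ => ?_
            split_ifs with hd
            · refine le_sum_accept T₁ _ hP₁' O.2 O.1 hT₁ d ?_
              rw [markedMass_eq_outcomeProb, hd]
              exact (Real.le_sqrt' hhi).2 hx
            · exact Finset.sum_nonneg fun _ _ => Finset.sum_nonneg fun _ _ => by
                split_ifs <;> positivity
    have := le_sum_accept T₂ mark hP₂' (hVmem O) 1 hT₂ (s₀ := false) false
      (hhi'.trans (Real.sqrt_le_sqrt hm))
    rw [htrue]
    simpa only [Matrix.one_apply_eq, norm_one, one_pow, one_mul] using this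

end Assembly

/-! ### Choice of parameters and the final bounds. -/

theorem PhaseTest.Separates.mono {κ : Type*} [Fintype κ] [DecidableEq κ] {T : PhaseTest κ}
    {lo hi η η' : ℝ} (h : T.Separates lo hi η) (hη : η ≤ η') : T.Separates lo hi η' := fun φ =>
  ⟨fun hlo => ((h φ).1 hlo).trans hη, fun hhi => le_trans (by linarith) ((h φ).2 hhi)⟩

theorem exists_two_pow_near {x : ℝ} (hx : 1 ≤ x) :
    ∃ r : ℕ, x ≤ 2 ^ r ∧ (2 : ℝ) ^ r ≤ 2 * x ∧ (r : ℝ) ≤ Real.logb 2 x + 1 := by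
  obtain ⟨k, hk, hk'⟩ := exists_nat_pow_near hx (one_lt_two : (1 : ℝ) < 2)
  refine ⟨k + 1, hk'.le, by rw [pow_succ]; linarith, ?_⟩
  push_cast
  have : (k : ℝ) ≤ Real.logb 2 x := by
    rw [Real.le_logb_iff_rpow_le one_lt_two (by linarith), Real.rpow_natCast]
    exact hk
  linarith

theorem lemma1 :
    ∃ C : ℝ, 0 < C ∧
      ∀ (m n a : ℕ) (τ ε δ : ℝ), m = 2 ^ n → 0 < n + a →
        0 < τ → τ < 1 → 0 < ε → ε < τ → 0 < δ → δ < 1 / 2 →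
        ∃ (N : ℕ) (A : QueryAlgorithm n a N),
          (N : ℝ) ≤
              C * ((Real.logb 2 (m : ℝ) + Real.logb 2 (1 / ε) + (a : ℝ)) *
                Real.logb 2 (1 / (δ * τ))) ∧
          (A.queries : ℝ) ≤ C * (1 / (ε * √τ) * Real.logb 2 (1 / (δ * τ))) ∧
          ∀ O : DistOracle n a,
            ((∀ x : BitString n, O.outcomeProb x < τ - ε) → 1 - δ ≤ A.outputProb O false) ∧
            ((∃ x : BitString n, τ ≤ O.outcomeProb x) → 1 - δ ≤ A.outputProb O true) := by
  refine ⟨300000, by norm_num, fun m n a τ ε δ hm hna hτ hτ1 hε hετ hδ hδ1 => ?_⟩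
  have hsτ : 0 < √τ := Real.sqrt_pos.2 hτ
  have hsτ1 : √τ ≤ 1 := Real.sqrt_le_one.2 hτ1.le
  have hsq : √τ * √τ = τ := Real.mul_self_sqrt hτ.le
  have hε1 : ε < 1 := hετ.trans hτ1
  have h1ε : 1 ≤ 1 / ε := by rw [le_div_iff₀ hε]; linarith
  have h1τ : 1 ≤ 1 / √τ := by rw [le_div_iff₀ hsτ]; linarith
  have hτε : 1 / √τ ≤ 1 / ε := one_div_le_one_div_of_le hε (by nlinarith)
  have h1δ : 2 ≤ 1 / δ := by rw [le_div_iff₀ hδ]; linarith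
  -- The factor 64 makes the inner clock length times the gap `ε / (2√τ)` at least `32 / √τ`, hence
  -- the inner error at most `τ / 32`. The factor 128 makes the outer clock length times the gap `√τ
  -- / 4` at least 32, hence the error before voting at most 1/32.
  obtain ⟨r₁, hr₁, hr₁', hr₁l⟩ := exists_two_pow_near (x := 64 * (1 / ε)) (by linarith)
  obtain ⟨r₂, hr₂, hr₂', hr₂l⟩ := exists_two_pow_near (x := 128 * (1 / √τ)) (by linarith)
  obtain ⟨L, hL, -, hLl⟩ := exists_two_pow_near (x := 1 / δ) (by linarith)
  have two_le : ∀ r : ℕ, (64 : ℝ) ≤ 2 ^ r → 2 ≤ r := by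
    intro r hr
    by_contra h
    have : (2 : ℝ) ^ r ≤ 2 ^ 1 := pow_le_pow_right₀ one_le_two (by omega)
    linarith
  have hlo : √(τ - ε) < √τ := Real.sqrt_lt_sqrt (by linarith) (by linarith)
  have hgap : ε / (2 * √τ) ≤ √τ - √(τ - ε) := by
    rw [div_le_iff₀ (by positivity)]
    have h := Real.mul_self_sqrt (show 0 ≤ τ - ε by linarith)
    nlinarith
  obtain ⟨T₁, hT₁K, hT₁⟩ := PhaseTest.exists_separates (two_le r₁ (by linarith)) hlo
  have hT₁' : T₁.Separates (√(τ - ε)) (√τ) (τ / 16) := by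
    refine hT₁.mono ?_
    have h : 32 * (1 / √τ) ≤ 2 ^ r₁ * (√τ - √(τ - ε)) := by
      calc 32 * (1 / √τ) = 64 * (1 / ε) * (ε / (2 * √τ)) := by field_simp; norm_num
        _ ≤ _ := by gcongr
    calc 32 / (2 ^ r₁ * (√τ - √(τ - ε))) ^ 2 ≤ 32 / (32 * (1 / √τ)) ^ 2 := by gcongr
      _ = (√τ * √τ) / 32 := by field_simp
      _ ≤ τ / 16 := by rw [hsq]; linarith
  have hgap₂ : 32 / (2 ^ r₂ * (√τ / 2 - √τ / 4)) ^ 2 ≤ 1 / 16 := by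
    have h : 32 ≤ 2 ^ r₂ * (√τ / 2 - √τ / 4) := by
      calc (32 : ℝ) = 128 * (1 / √τ) * (√τ / 2 - √τ / 4) := by field_simp; norm_num
        _ ≤ _ := by
          refine mul_le_mul_of_nonneg_right hr₂ (by linarith)
    calc 32 / (2 ^ r₂ * (√τ / 2 - √τ / 4)) ^ 2 ≤ 32 / 32 ^ 2 := by gcongr
      _ ≤ 1 / 16 := by norm_num
  obtain ⟨T₂, hT₂K, hT₂⟩ := PhaseTest.exists_separates_majority (two_le r₂ (by linarith)) L
    (show √τ / 4 < √τ / 2 by linarith) hgap₂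
  have hT₂' : T₂.Separates (√τ / 4) (√τ / 2) δ := by
    refine hT₂.mono ?_
    rw [one_div, inv_pow, inv_le_comm₀ (by positivity) hδ, ← one_div]
    exact hL
  obtain ⟨A, hA, hAO⟩ := exists_detector (n := n) (a := a) T₁ T₂ hT₁K hT₂K hsτ hT₁' hT₂'
    (by linarith) (le_of_eq (by
      rw [show τ / 16 = (√τ / 4) ^ 2 by rw [div_pow, sq, hsq]; norm_num]
      exact Real.sqrt_sq (by positivity)))
    -- This amounts to `τ / 4 ≤ τ (1 - τ / 16)`, which holds because `τ < 1`.
    (Real.le_sqrt_of_sq_le (by rw [div_pow, sq, hsq]; nlinarith))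
  have hlogε : 0 ≤ Real.logb 2 (1 / ε) := Real.logb_nonneg one_lt_two h1ε
  have hlogτ : 0 ≤ Real.logb 2 (1 / τ) :=
    Real.logb_nonneg one_lt_two (by rw [le_div_iff₀ hτ]; linarith)
  have hlogδ : 1 ≤ Real.logb 2 (1 / δ) := by
    rw [Real.le_logb_iff_rpow_le one_lt_two (by positivity), Real.rpow_one]
    exact h1δ
  have hΛ : Real.logb 2 (1 / (δ * τ)) = Real.logb 2 (1 / δ) + Real.logb 2 (1 / τ) := by
    rw [← Real.logb_mul (by positivity) (by positivity), div_mul_div_comm, one_mul]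
  have hlogm : Real.logb 2 (m : ℝ) = n := by
    rw [hm]; push_cast
    rw [← Real.rpow_natCast, Real.logb_rpow (by norm_num) (by norm_num)]
  have hlog2 : ∀ (k : ℕ) (x : ℝ), 0 < x → Real.logb 2 (2 ^ k * x) = k + Real.logb 2 x := by
    intro k x hx
    rw [Real.logb_mul (by positivity) hx.ne', ← Real.rpow_natCast,
      Real.logb_rpow (by norm_num) (by norm_num)]
  have h₁ : (r₁ : ℝ) ≤ 7 + Real.logb 2 (1 / ε) := by
    have := hlog2 6 (1 / ε) (by positivity)
    norm_num at this hr₁l ⊢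
    linarith
  have h₂ : (r₂ : ℝ) ≤ 8 + Real.logb 2 (1 / ε) := by
    have h := hlog2 7 (1 / √τ) (by positivity)
    have h' : Real.logb 2 (1 / √τ) ≤ Real.logb 2 (1 / ε) :=
      Real.logb_le_logb_of_le one_lt_two (by positivity) hτε
    norm_num at h h' hr₂l ⊢
    linarith
  have hS : (1 : ℝ) ≤ n + a := by exact_mod_cast hna
  set ℓ := Real.logb 2 (1 / ε)
  set Λ := Real.logb 2 (1 / (δ * τ))
  have hΛ1 : 1 ≤ Λ := by linarith
  -- The rounding in `L ≤ log (1 / δ) + 1` is absorbed because `δ < 1 / 2` makes the logarithm at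
  -- least 1.
  have hLΛ : (L : ℝ) ≤ 2 * Λ := by linarith
  refine ⟨_, A, ?_, ?_, fun O => ⟨fun h => (hAO O).1 fun x => Real.sqrt_le_sqrt (h x).le, ?_⟩⟩
  · rw [hlogm]
    push_cast
    have h3 : (L : ℝ) * r₂ ≤ 2 * Λ * (8 * (n + ℓ + a) + (n + ℓ + a)) :=
      mul_le_mul hLΛ (by linarith [n.cast_nonneg (α := ℝ), a.cast_nonneg (α := ℝ)])
        (by positivity) (by positivity)
    have h4 : (n + ℓ + a : ℝ) ≤ (n + ℓ + a) * Λ :=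
      le_mul_of_one_le_right (by positivity) hΛ1
    nlinarith
  · rw [hA]
    push_cast
    -- Here `258 = 2 + 2 * 128` and, below, `1025 = 1 + 2 * 2 * 256`; their product 264450 dictates
    -- the constant.
    have h3 : (2 + 2 * 2 ^ r₁ : ℝ) ≤ 258 * (1 / ε) := by linarith
    have h4 : (1 + 2 * (L * 2 ^ r₂) : ℝ) ≤ 1025 * (Λ * (1 / √τ)) := by
      have h5 : (L : ℝ) * 2 ^ r₂ ≤ 2 * Λ * (256 * (1 / √τ)) :=
        mul_le_mul hLΛ (by linarith) (by positivity) (by positivity)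
      have h6 : 1 ≤ Λ * (1 / √τ) := one_le_mul_of_one_le_of_one_le hΛ1 h1τ
      linarith
    calc ((2 + 2 * 2 ^ r₁) * (1 + 2 * (L * 2 ^ r₂)) : ℝ)
        ≤ 258 * (1 / ε) * (1025 * (Λ * (1 / √τ))) :=
          mul_le_mul h3 h4 (by positivity) (by positivity)
      _ = 264450 * (1 / (ε * √τ) * Λ) := by field_simp; norm_num
      _ ≤ 300000 * (1 / (ε * √τ) * Λ) := by
        refine mul_le_mul_of_nonneg_right (by norm_num) (by positivity)
  · rintro ⟨x, hx⟩
    exact (hAO O).2 ⟨x, by rwa [sq, hsq]⟩
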